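/- Let $\ell>0$ and let $\gamma=(\xi,\eta):\mathbb{R}/\ell\mathbb{Z}\to\mathbb{R}^2$ be a smooth simple closed curve parametrized by arc length $s$, with signed curvature $\kappa=\xi'\eta''-\eta'\xi''$. Assume that $\kappa(s)>0$ for every $s$. Let $B=-(2\kappa)^{-1}\,d^2/ds^2$, acting on the complex Hilbert space $L^2(\mathbb{R}/\ell\mathbb{Z},\kappa\,ds)$ with domain $C^\infty(\mathbb{R}/\ell\mathbb{Z})$. Then $B$ is nonnegative and essentially self-adjoint (that is, its closure is self-adjoint), the closure of $B$ has a smallest positive eigenvalue $\lambda_1(B)$, and $$\lambda_1(B)\le\frac{1}{4\pi}\int_{\mathbb{R}/\ell\mathbb{Z}}\kappa^2\,ds .$$ Equality holds if and only if $\kappa$ is constant. Moreover, $\kappa$ is constant if and only if the image of $\gamma$ is a circle of radius $\frac{1}{2\lambda_1(B)}$. -/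

import Mathlib

open MeasureTheory
open scoped ContDiff

namespace CurveSpectrum

noncomputable section

/-- A function on the circle `ℝ/ℓℤ` is smooth if its `ℓ`-periodic lift to `ℝ` is `C^∞`. -/
def IsSmooth {ℓ : ℝ} {E : Type*} [NormedAddCommGroup E] [NormedSpace ℝ E]
    (f : AddCircle ℓ → E) : Prop :=
  ContDiff ℝ ∞ (fun s : ℝ => f (s : AddCircle ℓ))

/-- The derivative `d/ds` of a function on the circle `ℝ/ℓℤ`. -/
def circleDeriv {ℓ : ℝ} {E : Type*} [NormedAddCommGroup E] [NormedSpace ℝ E]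
    (f : AddCircle ℓ → E) (x : AddCircle ℓ) : E :=
  deriv (fun t : ℝ => f (x + (t : AddCircle ℓ))) 0

/-- `γ : ℝ/ℓℤ → ℝ²` is a smooth simple closed curve, parametrized by arc length. -/
structure IsSmoothSimpleClosedArcLength {ℓ : ℝ}
    (γ : AddCircle ℓ → EuclideanSpace ℝ (Fin 2)) : Prop where
  smooth : IsSmooth γ
  simple : Function.Injective γ
  arcLength : ∀ s, ‖circleDeriv γ s‖ = 1

/-- The (signed) curvature `ξ' η'' - η' ξ''` of an arc-length parametrized plane curve
`γ = (ξ, η)`. -/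
def curvature {ℓ : ℝ} (γ : AddCircle ℓ → EuclideanSpace ℝ (Fin 2)) (s : AddCircle ℓ) : ℝ :=
  circleDeriv γ s 0 * circleDeriv (circleDeriv γ) s 1
    - circleDeriv γ s 1 * circleDeriv (circleDeriv γ) s 0

/-- The measure `κ ds` on `ℝ/ℓℤ`, where `ds` has total mass `ℓ`. -/
def weight {ℓ : ℝ} [Fact (0 < ℓ)] (κ : AddCircle ℓ → ℝ) : Measure (AddCircle ℓ) :=
  (volume : Measure (AddCircle ℓ)).withDensity (fun s => ENNReal.ofReal (κ s))

theorem circleDeriv_coe {ℓ : ℝ} {E : Type*} [NormedAddCommGroup E] [NormedSpace ℝ E]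
    (f : AddCircle ℓ → E) (s : ℝ) :
    circleDeriv f (s : AddCircle ℓ) = deriv (fun t : ℝ => f (t : AddCircle ℓ)) s := by
  have h := deriv_comp_const_add (fun t : ℝ => f (t : AddCircle ℓ)) s 0
  simp only [add_zero] at h
  rw [← h]
  simp [circleDeriv]

theorem IsSmooth.circleDeriv {ℓ : ℝ} {E : Type*} [NormedAddCommGroup E] [NormedSpace ℝ E]
    {f : AddCircle ℓ → E} (hf : IsSmooth f) : IsSmooth (circleDeriv f) := by
  unfold IsSmooth at *
  simp only [circleDeriv_coe]
  exact (contDiff_infty_iff_deriv.1 hf).2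

theorem IsSmooth.differentiable {ℓ : ℝ} {E : Type*} [NormedAddCommGroup E] [NormedSpace ℝ E]
    {f : AddCircle ℓ → E} (hf : IsSmooth f) :
    Differentiable ℝ (fun s : ℝ => f (s : AddCircle ℓ)) :=
  (contDiff_infty_iff_deriv.1 hf).1

theorem IsSmooth.continuous {ℓ : ℝ} {E : Type*} [NormedAddCommGroup E] [NormedSpace ℝ E]
    {f : AddCircle ℓ → E} (hf : IsSmooth f) : Continuous f :=
  isQuotientMap_quotient_mk'.continuous_iff.2 (ContDiff.continuous hf)

theorem circleDeriv_add {ℓ : ℝ} {f g : AddCircle ℓ → ℂ} (hf : IsSmooth f) (hg : IsSmooth g) :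
    circleDeriv (f + g) = circleDeriv f + circleDeriv g := by
  funext x
  induction x using QuotientAddGroup.induction_on with
  | H s =>
    have := deriv_add (hf.differentiable s) (hg.differentiable s)
    rw [Pi.add_apply, circleDeriv_coe, circleDeriv_coe, circleDeriv_coe, ← this]
    rfl

theorem circleDeriv_smul {ℓ : ℝ} (c : ℂ) {f : AddCircle ℓ → ℂ} (hf : IsSmooth f) :
    circleDeriv (c • f) = c • circleDeriv f := by
  funext x
  induction x using QuotientAddGroup.induction_on with
  | H s =>
    have := deriv_const_smul c (hf.differentiable s)
    rw [Pi.smul_apply, circleDeriv_coe, circleDeriv_coe, ← this]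
    rfl

/-- The graph, in `L²(κ ds) × L²(κ ds)`, of the operator `v ↦ -(2κ)⁻¹ v''` with domain the
smooth functions on `ℝ/ℓℤ`. -/
def operatorGraph {ℓ : ℝ} [Fact (0 < ℓ)] (κ : AddCircle ℓ → ℝ) :
    Submodule ℂ (Lp ℂ 2 (weight κ) × Lp ℂ 2 (weight κ)) where
  carrier := {z | ∃ v : AddCircle ℓ → ℂ, IsSmooth v ∧ z.1 =ᵐ[weight κ] v ∧
    z.2 =ᵐ[weight κ] fun s => -(2 * (κ s : ℂ))⁻¹ * circleDeriv (circleDeriv v) s}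
  zero_mem' := by
    refine ⟨0, contDiff_const, Lp.coeFn_zero _ _ _, ?_⟩
    have h : circleDeriv (0 : AddCircle ℓ → ℂ) = 0 := by
      funext x; simp [circleDeriv]
    refine (Lp.coeFn_zero ℂ 2 (weight κ)).trans (Filter.Eventually.of_forall fun s => ?_)
    simp [h]
  add_mem' := by
    rintro ⟨a, b⟩ ⟨c, d⟩ ⟨v, hv, h1, h2⟩ ⟨w, hw, h3, h4⟩
    refine ⟨v + w, ContDiff.add hv hw, (Lp.coeFn_add a c).trans (h1.add h3),
      (Lp.coeFn_add b d).trans ((h2.add h4).trans (Filter.Eventually.of_forall fun s => ?_))⟩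
    simp only [circleDeriv_add hv hw, circleDeriv_add hv.circleDeriv hw.circleDeriv, Pi.add_apply]
    ring
  smul_mem' := by
    rintro c ⟨a, b⟩ ⟨v, hv, h1, h2⟩
    refine ⟨c • v, ContDiff.const_smul c hv, (Lp.coeFn_smul c a).trans (h1.const_smul c),
      (Lp.coeFn_smul c b).trans
        ((h2.const_smul c).trans (Filter.Eventually.of_forall fun s => ?_))⟩
    simp only [circleDeriv_smul c hv, circleDeriv_smul c hv.circleDeriv, Pi.smul_apply,
      smul_eq_mul]
    ring

/-- The unbounded operator `B = -(2κ)⁻¹ d²/ds²` on `L²(ℝ/ℓℤ, κ ds)` (complex-valued functions),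
with domain `C^∞(ℝ/ℓℤ)`. -/
def operatorB {ℓ : ℝ} [Fact (0 < ℓ)] (κ : AddCircle ℓ → ℝ) :
    Lp ℂ 2 (weight κ) →ₗ.[ℂ] Lp ℂ 2 (weight κ) :=
  (operatorGraph κ).toLinearPMap

/-- For continuous positive `κ` the relation above is single-valued, so that it is the graph
of `operatorB κ`. -/
theorem operatorB_graph {ℓ : ℝ} [Fact (0 < ℓ)] {κ : AddCircle ℓ → ℝ} (hκ : Continuous κ)
    (hpos : ∀ s, 0 < κ s) : (operatorB κ).graph = operatorGraph κ := by
  refine Submodule.toLinearPMap_graph_eq _ ?_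
  rintro ⟨a, b⟩ ⟨v, hv, h1, h2⟩ (h0 : a = 0)
  have hac : (volume : Measure (AddCircle ℓ)) ≪ weight κ := by
    refine withDensity_absolutelyContinuous' ?_ ?_
    · exact (ENNReal.measurable_ofReal.comp hκ.measurable).aemeasurable
    · exact Filter.Eventually.of_forall fun s => by simp [hpos s]
  have hv0 : v = 0 := by
    have h3 : v =ᵐ[weight κ] 0 := by
      subst h0
      exact h1.symm.trans (Lp.coeFn_zero _ _ _)
    exact Continuous.ae_eq_iff_eq volume hv.continuous continuous_const |>.1 (hac.ae_eq h3)
  subst hv0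
  have h : circleDeriv (0 : AddCircle ℓ → ℂ) = 0 := by
    funext x; simp [circleDeriv]
  refine Lp.ext (h2.trans (Filter.EventuallyEq.trans ?_ (Lp.coeFn_zero ℂ 2 (weight κ)).symm))
  exact Filter.Eventually.of_forall fun s => by simp [h]

/-- An unbounded operator is essentially self-adjoint if its closure is self-adjoint. -/
def IsEssentiallySelfAdjoint {H : Type*} [NormedAddCommGroup H] [InnerProductSpace ℂ H]
    [CompleteSpace H] (A : H →ₗ.[ℂ] H) : Prop :=
  A.IsClosable ∧ IsSelfAdjoint A.closure

/-- An unbounded operator is nonnegative if `⟨A u, u⟩ ≥ 0` (real and nonnegative) on its domain. -/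
def IsNonnegative {H : Type*} [NormedAddCommGroup H] [InnerProductSpace ℂ H]
    (A : H →ₗ.[ℂ] H) : Prop :=
  ∀ u : A.domain, (inner ℂ (A u) (u : H)).im = 0 ∧ 0 ≤ (inner ℂ (A u) (u : H)).re

/-- The positive eigenvalues of the closure of an unbounded operator
(the self-adjoint operator it defines, if it is essentially self-adjoint). -/
def positiveEigenvalues {H : Type*} [NormedAddCommGroup H] [InnerProductSpace ℂ H]
    (A : H →ₗ.[ℂ] H) : Set ℝ :=
  {μ | 0 < μ ∧ ∃ u : A.closure.domain, (u : H) ≠ 0 ∧ A.closure u = (μ : ℂ) • (u : H)}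

end

end CurveSpectrum

/-!
In terms of the tangent angle `θ`, `dθ = κ ds`, the operator `B` is `-(1/2) d/dθ (κ d/dθ)` on
`L²(dθ)`, and the unit tangent `τ = ξ' + iη' = e^{iθ}` is a test function for its first positive
eigenvalue. By the Frenet equation `τ' = iκτ` (`circleDeriv_tangent`), `τ` is orthogonal to the
constants, `‖τ‖² = ∫ κ ds`, and `⟪τ, B τ⟫ = (1/2) ∫ κ² ds`. As `τ` is periodic and `κ > 0`, the
total curvature is a positive multiple of `2π` (`two_pi_le_integral_curvature`), so
`2π λ₁ ≤ λ₁ ‖τ‖² ≤ (1/2) ∫ κ² ds`. In case of equality `τ` is an eigenfunction, `B τ = λ₁ τ`, and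
the real part of this equation reads `κ = 2λ₁`. Simplicity of the curve matters only when `κ = c`
is constant: it makes the curve run once around its circle, so that `cℓ = 2π`
(`mul_length_eq_two_pi`), and then `B` is diagonalized by the trigonometric monomials, with
eigenvalues `c n² / 2`.

The spectral theory of `B` is read off from a bounded operator. The rank-one series
`∑ aₙ ⟪eₙ, ·⟫ eₙ` over the nonzero frequencies, `eₙ` being the trigonometric monomials regarded in
`L²(κ ds)`, is compact and positive, and `green_applyB` shows that it inverts `B` up to constants:
this is the convergence of the Fourier series of a smooth function. Compressed to the orthogonal
complement of the constants it is a reduced inverse `G` in the sense of `IsReducedInverse`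
(`isReducedInverse_reducedGreen`). Whenever such a `G` exists, the closure of the graph consists of
the pairs `(G w + c e, w)` with `w ⟂ e` and coincides with the graph of the adjoint. This gives
essential self-adjointness, identifies the positive eigenvalues with the inverses of those of `G`,
and yields `‖G‖⁻¹` as the smallest one. The variational inequality and its equality case are the
inequality `‖G f‖² ≤ ‖G‖ ⟪G f, f⟫` for positive operators (`norm_sq_le_of_isPositive`,
`apply_apply_eq_of_norm_sq_eq`).
-/

namespace CurveSpectrum

open scoped ComplexOrder

/-! ### Compact positive operators -/

section Positive

variable {H : Type*} [NormedAddCommGroup H] [InnerProductSpace ℂ H]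

/-- For a positive operator `G`, the complementary operator `‖G‖ - G` is positive too. -/
theorem isPositive_norm_sub {G : H →L[ℂ] H} (hG : G.IsPositive) :
    ((‖G‖ : ℂ) • (1 : H →L[ℂ] H) - G).IsPositive := by
  rw [ContinuousLinearMap.isPositive_def]
  constructor
  · intro x y
    have := hG.inner_left_eq_inner_right x y
    simp only [ContinuousLinearMap.coe_coe, sub_apply, FunLike.coe_smul, Pi.smul_apply,
      one_apply_eq_self, inner_sub_left, inner_sub_right, inner_smul_left, inner_smul_right,
      Complex.conj_ofReal, this]
  · intro x
    have h1 : (inner ℂ (G x) x).re ≤ ‖G‖ * ‖x‖ ^ 2 := by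
      calc (inner ℂ (G x) x).re ≤ ‖inner ℂ (G x) x‖ := Complex.re_le_norm _
        _ ≤ ‖G x‖ * ‖x‖ := norm_inner_le_norm _ _
        _ ≤ ‖G‖ * ‖x‖ * ‖x‖ := by gcongr; exact G.le_opNorm x
        _ = _ := by ring
    have h2 : (inner ℂ ((‖G‖ : ℂ) • x) x).re = ‖G‖ * ‖x‖ ^ 2 := by
      rw [inner_smul_left, inner_self_eq_norm_sq_to_K, Complex.conj_ofReal]
      simp only [Complex.coe_algebraMap]
      norm_cast
    simp only [ContinuousLinearMap.reApplyInnerSelf_apply, sub_apply,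
      FunLike.coe_smul, Pi.smul_apply, one_apply_eq_self,
      inner_sub_left, RCLike.re_to_complex, Complex.sub_re, h2]
    linarith

/-- Writing `P = ‖G‖ - G`, the identity `‖G‖ ⟪P f, G f⟫ = ⟪G P f, P f⟫ + ⟪P G f, G f⟫` presents the
defect in `‖G f‖² ≤ ‖G‖ ⟪G f, f⟫` as a sum of two nonnegative terms. -/
theorem norm_mul_defect_eq {G : H →L[ℂ] H} (hG : G.IsPositive) (f : H) :
    ‖G‖ * (‖G‖ * (inner ℂ (G f) f).re - ‖G f‖ ^ 2) =
      (inner ℂ (G ((‖G‖ : ℂ) • f - G f)) ((‖G‖ : ℂ) • f - G f)).re +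
      (inner ℂ ((‖G‖ : ℂ) • G f - G (G f)) (G f)).re := by
  have h1 := hG.inner_left_eq_inner_right (G f) f
  have h2 : ‖G f‖ ^ 2 = (inner ℂ (G f) (G f)).re := (inner_self_eq_norm_sq (𝕜 := ℂ) (G f)).symm
  simp only [map_sub, map_smul, inner_sub_left, inner_sub_right, inner_smul_left,
    inner_smul_right, Complex.conj_ofReal, Complex.sub_re, Complex.re_ofReal_mul, h1, h2]
  ring

theorem norm_sq_le_of_isPositive {G : H →L[ℂ] H} (hG : G.IsPositive) (f : H) :
    ‖G f‖ ^ 2 ≤ ‖G‖ * (inner ℂ (G f) f).re := by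
  rcases (norm_nonneg G).eq_or_lt with h | h
  · have : G = 0 := norm_eq_zero.1 h.symm
    simp [this]
  · have h1 := norm_mul_defect_eq hG f
    have h2 := hG.re_inner_nonneg_left ((‖G‖ : ℂ) • f - G f)
    have h3 := (isPositive_norm_sub hG).re_inner_nonneg_left (G f)
    simp only [RCLike.re_to_complex, sub_apply, FunLike.coe_smul,
      Pi.smul_apply, one_apply_eq_self] at h2 h3
    nlinarith [nonneg_of_mul_nonneg_right (h1 ▸ add_nonneg h2 h3) h]

/-- Equality in `‖G f‖² ≤ ‖G‖ ⟪G f, f⟫` forces `G f` to be an eigenvector for the top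
eigenvalue. -/
theorem apply_apply_eq_of_norm_sq_eq {G : H →L[ℂ] H} (hG : G.IsPositive) {f : H}
    (hf : ‖G f‖ ^ 2 = ‖G‖ * (inner ℂ (G f) f).re) : G (G f) = (‖G‖ : ℂ) • G f := by
  have h1 := norm_mul_defect_eq hG f
  have h2 := hG.re_inner_nonneg_left ((‖G‖ : ℂ) • f - G f)
  have hP := isPositive_norm_sub hG
  have h3 := hP.re_inner_nonneg_left (G f)
  have h4 := norm_sq_le_of_isPositive hP (G f)
  simp only [RCLike.re_to_complex, sub_apply, FunLike.coe_smul,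
    Pi.smul_apply, one_apply_eq_self] at h2 h3 h4
  have h5 : (inner ℂ ((‖G‖ : ℂ) • G f - G (G f)) (G f)).re = 0 := by
    rw [hf, sub_self, mul_zero] at h1
    linarith
  rw [h5, mul_zero] at h4
  have h6 : ‖(‖G‖ : ℂ) • G f - G (G f)‖ = 0 := by
    nlinarith [norm_nonneg ((‖G‖ : ℂ) • G f - G (G f))]
  exact (sub_eq_zero.1 (norm_eq_zero.1 h6)).symm

/-- A nonzero compact positive operator attains its norm as an eigenvalue: its spectral radius
is `‖G‖`, and nonzero points of the spectrum of a compact operator are eigenvalues. -/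
theorem exists_apply_eq_norm_smul [CompleteSpace H] {G : H →L[ℂ] H} (hG : G.IsPositive)
    (hc : IsCompactOperator G) (h0 : G ≠ 0) : ∃ x : H, x ≠ 0 ∧ G x = (‖G‖ : ℂ) • x := by
  have : Nontrivial H := by
    by_contra h
    rw [not_nontrivial_iff_subsingleton] at h
    exact h0 (Subsingleton.elim _ _)
  obtain ⟨k, hk, hkn⟩ := spectrum.exists_nnnorm_eq_spectralRadius G
  rw [G.spectralRadius_eq_nnnorm hG.isSelfAdjoint, ENNReal.coe_inj] at hkn
  have hkn' : ‖k‖ = ‖G‖ := congrArg NNReal.toReal hkn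
  have hk0 : k ≠ 0 := by
    rintro rfl
    exact h0 (norm_eq_zero.1 (by simpa using hkn'.symm))
  obtain ⟨x, hx, hx0⟩ := ((hc.hasEigenvalue_iff_mem_spectrum hk0).2 hk).exists_hasEigenvector
  have hx' : G x = k • x := by simpa using Module.End.mem_eigenspace_iff.1 hx
  refine ⟨x, hx0, ?_⟩
  have h1 : (0 : ℂ) ≤ inner ℂ x (G x) := hG.inner_nonneg_right x
  rw [hx', inner_smul_right, inner_self_eq_norm_sq_to_K] at h1
  have hxp : (0 : ℝ) < ‖x‖ ^ 2 := by positivity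
  have hk1 : (0 : ℂ) ≤ k := by
    have h2 : k = (k * ((‖x‖ : ℂ)) ^ 2) * (((‖x‖ ^ 2)⁻¹ : ℝ) : ℂ) := by
      push_cast
      rw [mul_assoc, mul_inv_cancel₀ (by exact_mod_cast hxp.ne'), mul_one]
    rw [h2]
    exact mul_nonneg h1 (by exact_mod_cast (inv_pos.2 hxp).le)
  rw [hx', ← hkn', Complex.norm_of_nonneg' hk1]

end Positive

/-! ### Operators with a compact positive inverse modulo a one-dimensional kernel -/

section Reduced

variable {H : Type*} [NormedAddCommGroup H] [InnerProductSpace ℂ H]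

/-- `G` is a compact positive inverse of the densely defined operator `A` modulo its kernel, the
line `ℂ ∙ e`: `G` kills `e`, the range of `A` is orthogonal to `e` and to nothing outside
`ℂ ∙ e`, and `u - G (A u)` lies in `ℂ ∙ e`. -/
structure IsReducedInverse (A : H →ₗ.[ℂ] H) (e : H) (G : H →L[ℂ] H) : Prop where
  compact : IsCompactOperator G
  positive : G.IsPositive
  dense : Dense (A.domain : Set H)
  ne_zero : e ≠ 0
  apply_self : G e = 0
  mem_graph : (e, (0 : H)) ∈ A.graph
  inner_eq_zero : ∀ u f, (u, f) ∈ A.graph → inner ℂ e f = 0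
  left_inv : ∀ u f, (u, f) ∈ A.graph → ∃ c : ℂ, u = G f + c • e
  mem_span : ∀ v, (∀ u f, (u, f) ∈ A.graph → inner ℂ f v = 0) → ∃ c : ℂ, v = c • e

namespace IsReducedInverse

variable {A : H →ₗ.[ℂ] H} {e : H} {G : H →L[ℂ] H}

theorem inner_apply_eq_zero (h : IsReducedInverse A e G) (x : H) : inner ℂ e (G x) = 0 := by
  rw [← h.positive.inner_left_eq_inner_right, h.apply_self, inner_zero_left]

/-- Symmetry of the relation `u ∈ G f + ℂ ∙ e`, `f ⟂ e`. -/
theorem inner_symm (h : IsReducedInverse A e G) {u f u' f' : H} {c c' : ℂ}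
    (hf : inner ℂ e f = 0) (hu : u = G f + c • e)
    (hf' : inner ℂ e f' = 0) (hu' : u' = G f' + c' • e) : inner ℂ f u' = inner ℂ u f' := by
  have h1 : inner ℂ f e = 0 := inner_eq_zero_symm.1 hf
  rw [hu, hu', inner_add_left, inner_add_right, inner_smul_left, inner_smul_right, h1, hf',
    mul_zero, mul_zero, h.positive.inner_left_eq_inner_right]

theorem isNonnegative (h : IsReducedInverse A e G) : IsNonnegative A := by
  intro u
  have hm : ((u : H), A u) ∈ A.graph := A.mem_graph u
  obtain ⟨c, hc⟩ := h.left_inv _ _ hm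
  have he : inner ℂ (A u) e = 0 := inner_eq_zero_symm.1 (h.inner_eq_zero _ _ hm)
  have h1 : inner ℂ (A u) (u : H) = inner ℂ (A u) (G (A u)) := by
    conv_lhs => rw [hc]
    rw [inner_add_right, inner_smul_right, he, mul_zero, add_zero]
  have h2 : (0 : ℂ) ≤ inner ℂ (A u) (G (A u)) := h.positive.inner_nonneg_right _
  rw [← h1, Complex.nonneg_iff] at h2
  exact ⟨h2.2.symm, h2.1⟩

theorem mem_adjoint_of_mem_closure (h : IsReducedInverse A e G) {x : H × H}
    (hx : x ∈ A.graph.topologicalClosure) : x ∈ A.graph.adjoint := by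
  rw [Submodule.mem_adjoint_iff]
  intro u f hf
  have hcl : IsClosed {x : H × H | inner ℂ f x.1 - inner ℂ u x.2 = 0} :=
    isClosed_eq (by fun_prop) continuous_const
  refine hcl.closure_subset_iff.2 ?_ hx
  rintro ⟨u', f'⟩ hf'
  obtain ⟨c, hc⟩ := h.left_inv _ _ hf
  obtain ⟨c', hc'⟩ := h.left_inv _ _ hf'
  exact sub_eq_zero.2
    (h.inner_symm (h.inner_eq_zero _ _ hf) hc (h.inner_eq_zero _ _ hf') hc')

theorem eq_apply (h : IsReducedInverse A e G) {u f : H} (hf : (u, f) ∈ A.graph)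
    (hu : inner ℂ e u = 0) : u = G f := by
  obtain ⟨c, hc⟩ := h.left_inv _ _ hf
  rw [hc, inner_add_right, h.inner_apply_eq_zero, zero_add, inner_smul_right] at hu
  rw [hc, (mul_eq_zero.1 hu).resolve_right (inner_self_ne_zero.2 h.ne_zero), zero_smul, add_zero]

/-- The variational bound for the smallest positive eigenvalue. -/
theorem rayleigh (h : IsReducedInverse A e G) (hG : G ≠ 0) {u f : H} (hf : (u, f) ∈ A.graph)
    (hu : inner ℂ e u = 0) : ‖G‖⁻¹ * ‖u‖ ^ 2 ≤ (inner ℂ u f).re := by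
  rw [h.eq_apply hf hu, inv_mul_le_iff₀ (norm_pos_iff.2 hG)]
  exact norm_sq_le_of_isPositive h.positive f

/-- Eigenvectors of `A` and of its reduced inverse that are not orthogonal belong to the same
eigenvalue. -/
theorem eigenvalue_eq_of_inner_ne_zero (h : IsReducedInverse A e G) {μ ν : ℝ} {u w : H}
    (hw : (w, (ν : ℂ) • w) ∈ A.graph) (hμ : 0 < μ) (hu : G u = ((μ⁻¹ : ℝ) : ℂ) • u)
    (hne : inner ℂ w u ≠ 0) : μ = ν := by
  have hμ' : (μ : ℂ) ≠ 0 := by exact_mod_cast hμ.ne'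
  have hu' : u = G ((μ : ℂ) • u) := by
    rw [map_smul, hu, smul_smul, Complex.ofReal_inv, mul_inv_cancel₀ hμ', one_smul]
  have h1 : inner ℂ e ((μ : ℂ) • u) = 0 := by
    rw [inner_smul_right, hu', h.inner_apply_eq_zero, mul_zero]
  obtain ⟨c, hc⟩ := h.left_inv _ _ hw
  have h2 := h.inner_symm (c' := 0) (h.inner_eq_zero _ _ hw) hc h1
    (by rw [zero_smul, add_zero, ← hu'])
  rw [inner_smul_left, inner_smul_right, Complex.conj_ofReal] at h2
  exact_mod_cast (mul_right_cancel₀ hne h2).symm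

variable [CompleteSpace H]

/-- The range of `A` is dense in the orthogonal complement of `e`, so `G` maps the latter into the
domain of the closure. -/
theorem apply_mem_closure (h : IsReducedInverse A e G) {w : H} (hw : inner ℂ e w = 0) :
    (G w, w) ∈ A.graph.topologicalClosure := by
  let R : Submodule ℂ H := A.graph.map (LinearMap.snd ℂ H H)
  have hR : w ∈ R.topologicalClosure := by
    rw [← Submodule.orthogonal_orthogonal_eq_closure, Submodule.mem_orthogonal]
    intro v hv
    obtain ⟨c, rfl⟩ := h.mem_span v fun u f hf => by
      rw [Submodule.mem_orthogonal] at hv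
      exact hv f ⟨(u, f), hf, rfl⟩
    rw [inner_smul_left, hw, mul_zero]
  have hcont : Continuous fun x : H => (G x, x) := G.continuous.prodMk continuous_id
  refine map_mem_closure (f := fun x : H => (G x, x)) hcont hR ?_
  rintro f ⟨⟨u, f'⟩, hf, rfl⟩
  obtain ⟨c, hc⟩ := h.left_inv _ _ hf
  have h1 : (G f', f') = (u, f') - c • (e, (0 : H)) := by
    rw [hc]
    ext <;> simp
  change (G f', f') ∈ A.graph
  exact h1 ▸ A.graph.sub_mem hf (A.graph.smul_mem c h.mem_graph)

theorem of_mem_adjoint (h : IsReducedInverse A e G) {v w : H} (hx : (v, w) ∈ A.graph.adjoint) :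
    inner ℂ e w = 0 ∧ ∃ c : ℂ, v = G w + c • e := by
  have hw : inner ℂ e w = 0 := by
    rw [Submodule.mem_adjoint_iff] at hx
    simpa using hx _ _ h.mem_graph
  refine ⟨hw, ?_⟩
  -- the difference `(v, w) - (G w, w)` is orthogonal to the range of `A`
  have h1 := A.graph.adjoint.sub_mem hx (h.mem_adjoint_of_mem_closure (h.apply_mem_closure hw))
  rw [Submodule.mem_adjoint_iff] at h1
  obtain ⟨c, hc⟩ := h.mem_span (v - G w) fun u f hf => by
    simpa [inner_sub_right] using h1 u f hf
  exact ⟨c, by rw [← hc]; abel⟩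

/-- The closure of the graph of `A`, in terms of its reduced inverse. -/
theorem mem_closure_iff (h : IsReducedInverse A e G) {v w : H} :
    (v, w) ∈ A.graph.topologicalClosure ↔ inner ℂ e w = 0 ∧ ∃ c : ℂ, v = G w + c • e := by
  refine ⟨fun hx => h.of_mem_adjoint (h.mem_adjoint_of_mem_closure hx), ?_⟩
  rintro ⟨hw, c, rfl⟩
  have h1 : (G w + c • e, w) = (G w, w) + c • (e, (0 : H)) := by ext <;> simp
  rw [h1]
  exact Submodule.add_mem _ (h.apply_mem_closure hw)
    (Submodule.smul_mem _ c (A.graph.le_topologicalClosure h.mem_graph))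

theorem isClosable (h : IsReducedInverse A e G) : A.IsClosable := by
  refine LinearPMap.isClosable_iff_exists_closed_extension.2
    ⟨A.adjoint, LinearPMap.adjoint_isClosed h.dense, LinearPMap.le_of_le_graph ?_⟩
  rw [LinearPMap.adjoint_graph_eq_graph_adjoint h.dense]
  exact fun x hx => h.mem_adjoint_of_mem_closure (A.graph.le_topologicalClosure hx)

theorem mem_graph_closure_iff (h : IsReducedInverse A e G) {v w : H} :
    (v, w) ∈ A.closure.graph ↔ inner ℂ e w = 0 ∧ ∃ c : ℂ, v = G w + c • e := by
  rw [← h.isClosable.graph_closure_eq_closure_graph, h.mem_closure_iff]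

theorem isEssentiallySelfAdjoint (h : IsReducedInverse A e G) : IsEssentiallySelfAdjoint A := by
  refine ⟨h.isClosable, ?_⟩
  have hd : Dense (A.closure.domain : Set H) := h.dense.mono A.le_closure.1
  rw [LinearPMap.isSelfAdjoint_def]
  refine LinearPMap.eq_of_eq_graph ?_
  rw [LinearPMap.adjoint_graph_eq_graph_adjoint hd]
  ext ⟨v, w⟩
  rw [h.mem_graph_closure_iff]
  constructor
  · intro hx
    refine h.of_mem_adjoint ?_
    rw [Submodule.mem_adjoint_iff] at hx ⊢
    exact fun a b hab => hx a b (LinearPMap.le_graph_of_le A.le_closure hab)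
  · rintro ⟨hw, c, hc⟩
    rw [Submodule.mem_adjoint_iff]
    intro a b hab
    obtain ⟨hb, c', hc'⟩ := h.mem_graph_closure_iff.1 hab
    exact sub_eq_zero.2 (h.inner_symm hb hc' hw hc)

/-- The positive eigenvalues of the closure are the inverses of those of the reduced inverse. -/
theorem mem_positiveEigenvalues_iff (h : IsReducedInverse A e G) {μ : ℝ} :
    μ ∈ positiveEigenvalues A ↔ 0 < μ ∧ ∃ u : H, u ≠ 0 ∧ G u = ((μ⁻¹ : ℝ) : ℂ) • u := by
  refine and_congr_right fun hμ => ?_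
  have hμ' : (μ : ℂ) ≠ 0 := by exact_mod_cast hμ.ne'
  constructor
  · rintro ⟨u, hu, hAu⟩
    obtain ⟨h1, c, hc⟩ := h.mem_graph_closure_iff.1 (hAu ▸ A.closure.mem_graph u)
    have h2 : inner ℂ e (u : H) = 0 := by
      rw [inner_smul_right] at h1
      exact (mul_eq_zero.1 h1).resolve_left hμ'
    have hc0 : c = 0 := by
      have h3 := h2
      rw [hc, inner_add_right, h.inner_apply_eq_zero, zero_add, inner_smul_right] at h3
      exact (mul_eq_zero.1 h3).resolve_right (inner_self_ne_zero.2 h.ne_zero)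
    refine ⟨u, hu, ?_⟩
    rw [hc0, zero_smul, add_zero, map_smul] at hc
    conv_rhs => rw [hc]
    rw [smul_smul, Complex.ofReal_inv, inv_mul_cancel₀ hμ', one_smul]
  · rintro ⟨u, hu, hGu⟩
    have hu' : u = G ((μ : ℂ) • u) := by
      rw [map_smul, hGu, smul_smul, Complex.ofReal_inv, mul_inv_cancel₀ hμ', one_smul]
    have h1 : inner ℂ e u = 0 := by rw [hu', h.inner_apply_eq_zero]
    have h2 : (u, (μ : ℂ) • u) ∈ A.closure.graph := by
      rw [h.mem_graph_closure_iff, inner_smul_right, h1, mul_zero]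
      exact ⟨rfl, 0, by rw [zero_smul, add_zero]; exact hu'⟩
    obtain ⟨y, hy1, hy2⟩ := (LinearPMap.mem_graph_iff _).1 h2
    exact ⟨y, by simpa [hy1] using hu, by simpa [hy1] using hy2⟩

theorem isLeast_positiveEigenvalues (h : IsReducedInverse A e G) (hG : G ≠ 0) :
    IsLeast (positiveEigenvalues A) ‖G‖⁻¹ := by
  have hpos : 0 < ‖G‖ := norm_pos_iff.2 hG
  constructor
  · rw [h.mem_positiveEigenvalues_iff, inv_inv]
    exact ⟨inv_pos.2 hpos, exists_apply_eq_norm_smul h.positive h.compact hG⟩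
  · intro μ hμ
    obtain ⟨hμ, u, hu, hGu⟩ := h.mem_positiveEigenvalues_iff.1 hμ
    have h1 := G.le_opNorm u
    rw [hGu, norm_smul, Complex.norm_real, Real.norm_of_nonneg (inv_pos.2 hμ).le] at h1
    exact inv_le_of_inv_le₀ hμ (le_of_mul_le_mul_right h1 (norm_pos_iff.2 hu))

/-- On the orthogonal complement of `e` the reduced inverse is injective. -/
theorem eq_zero_of_apply_eq_zero (h : IsReducedInverse A e G) {w : H} (hw : inner ℂ e w = 0)
    (hGw : G w = 0) : w = 0 := by
  have h1 := h.mem_adjoint_of_mem_closure (h.apply_mem_closure hw)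
  rw [hGw, Submodule.mem_adjoint_iff] at h1
  refine h.dense.eq_zero_of_inner_right ℂ fun u hu => ?_
  simpa using h1 u (A ⟨u, hu⟩) (A.mem_graph ⟨u, hu⟩)

/-- Equality in the variational bound holds for eigenvectors only. -/
theorem eq_smul_of_rayleigh_eq (h : IsReducedInverse A e G) (hG : G ≠ 0) {u f : H}
    (hf : (u, f) ∈ A.graph) (hu : inner ℂ e u = 0)
    (heq : ‖G‖⁻¹ * ‖u‖ ^ 2 = (inner ℂ u f).re) : f = ((‖G‖⁻¹ : ℝ) : ℂ) • u := by
  have hpos : 0 < ‖G‖ := norm_pos_iff.2 hG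
  have huf := h.eq_apply hf hu
  rw [huf, inv_mul_eq_iff_eq_mul₀ hpos.ne'] at heq
  have h1 := apply_apply_eq_of_norm_sq_eq h.positive heq
  have h2 : G f - (‖G‖ : ℂ) • f = 0 := by
    refine h.eq_zero_of_apply_eq_zero ?_ ?_
    · rw [inner_sub_right, inner_smul_right, h.inner_apply_eq_zero, h.inner_eq_zero _ _ hf,
        mul_zero, sub_zero]
    · rw [map_sub, map_smul, h1, sub_self]
  rw [huf, sub_eq_zero.1 h2, smul_smul, Complex.ofReal_inv,
    inv_mul_cancel₀ (by exact_mod_cast hpos.ne'), one_smul]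

end IsReducedInverse

end Reduced

/-! ### Smooth functions on the circle -/

section Smooth

variable {ℓ : ℝ}

theorem IsSmooth.of_fourier (n : ℤ) : IsSmooth (fourier n : AddCircle ℓ → ℂ) := by
  unfold IsSmooth
  simp only [fourier_coe_apply]
  have h : ContDiff ℝ ∞ fun s : ℝ => (2 * Real.pi * Complex.I * n * (s : ℂ) / ℓ : ℂ) :=
    (contDiff_const.mul Complex.ofRealCLM.contDiff).div_const _
  exact h.cexp

theorem IsSmooth.of_const (c : ℂ) : IsSmooth (fun _ : AddCircle ℓ => c) := contDiff_const

theorem IsSmooth.hasDerivAt {E : Type*} [NormedAddCommGroup E] [NormedSpace ℝ E]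
    {f : AddCircle ℓ → E} (hf : IsSmooth f) (s : ℝ) :
    HasDerivAt (fun t : ℝ => f (t : AddCircle ℓ))
      (CurveSpectrum.circleDeriv f (s : AddCircle ℓ)) s := by
  rw [circleDeriv_coe]
  exact (hf.differentiable s).hasDerivAt

theorem circleDeriv_eq_of_hasDerivAt {E : Type*} [NormedAddCommGroup E] [NormedSpace ℝ E]
    {f g : AddCircle ℓ → E}
    (h : ∀ s : ℝ, HasDerivAt (fun t : ℝ => f (t : AddCircle ℓ)) (g (s : AddCircle ℓ)) s) :
    circleDeriv f = g := by
  funext x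
  induction x using QuotientAddGroup.induction_on with
  | H s => exact (circleDeriv_coe f s).trans (h s).deriv

theorem circleDeriv_fourier (n : ℤ) :
    circleDeriv (fourier n : AddCircle ℓ → ℂ) =
      fun s => (2 * Real.pi * Complex.I * n / ℓ) * fourier n s :=
  circleDeriv_eq_of_hasDerivAt fun s => hasDerivAt_fourier ℓ n s

theorem circleDeriv_circleDeriv_fourier (n : ℤ) :
    circleDeriv (circleDeriv (fourier n : AddCircle ℓ → ℂ)) =
      fun s => -(((2 * Real.pi * n / ℓ) ^ 2 : ℝ) : ℂ) * fourier n s := by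
  have h := circleDeriv_smul (2 * Real.pi * Complex.I * n / ℓ : ℂ) (IsSmooth.of_fourier (ℓ := ℓ) n)
  have h1 : circleDeriv (fourier n : AddCircle ℓ → ℂ) =
      (2 * Real.pi * Complex.I * n / ℓ : ℂ) • (fourier n : AddCircle ℓ → ℂ) :=
    circleDeriv_fourier n
  rw [h1, h, h1]
  funext s
  simp only [Pi.smul_apply, smul_eq_mul]
  push_cast
  ring_nf
  simp only [Complex.I_sq]
  ring

variable {κ : AddCircle ℓ → ℝ}

/-- The function `B v = -(2κ)⁻¹ v''` for smooth `v`. -/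
noncomputable def applyB (hκ : Continuous κ) (hpos : ∀ s, 0 < κ s) {v : AddCircle ℓ → ℂ}
    (hv : IsSmooth v) : C(AddCircle ℓ, ℂ) where
  toFun s := -(2 * (κ s : ℂ))⁻¹ * circleDeriv (circleDeriv v) s
  continuous_toFun := by
    have h1 : Continuous fun s => (κ s : ℂ) := Complex.continuous_ofReal.comp hκ
    refine ((continuous_const.mul h1).inv₀ fun s => ?_).neg.mul
      hv.circleDeriv.circleDeriv.continuous
    exact mul_ne_zero two_ne_zero (Complex.ofReal_ne_zero.2 (hpos s).ne')

theorem mul_applyB (hκ : Continuous κ) (hpos : ∀ s, 0 < κ s) {v : AddCircle ℓ → ℂ}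
    (hv : IsSmooth v) (s : AddCircle ℓ) :
    (κ s : ℂ) * applyB hκ hpos hv s = -(1 / 2) * circleDeriv (circleDeriv v) s := by
  have h : (κ s : ℂ) ≠ 0 := Complex.ofReal_ne_zero.2 (hpos s).ne'
  simp only [applyB, ContinuousMap.coe_mk]
  field_simp

theorem applyB_fourier (hκ : Continuous κ) (hpos : ∀ s, 0 < κ s) (n : ℤ) (s : AddCircle ℓ) :
    applyB hκ hpos (IsSmooth.of_fourier n) s =
      (((2 * Real.pi * n / ℓ) ^ 2 / 2 : ℝ) : ℂ) * ((κ s : ℂ)⁻¹ * fourier n s) := by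
  have h : (κ s : ℂ) ≠ 0 := Complex.ofReal_ne_zero.2 (hpos s).ne'
  simp only [applyB, ContinuousMap.coe_mk, circleDeriv_circleDeriv_fourier]
  push_cast
  field_simp

/-- Integration by parts on the circle. -/
theorem fourierCoeff_circleDeriv [Fact (0 < ℓ)] {v : AddCircle ℓ → ℂ} (hv : IsSmooth v) (n : ℤ) :
    fourierCoeff (circleDeriv v) n = (2 * Real.pi * Complex.I * n / ℓ) * fourierCoeff v n := by
  rw [fourierCoeff_eq_intervalIntegral _ n 0, fourierCoeff_eq_intervalIntegral _ n 0]
  have h := intervalIntegral.integral_mul_deriv_eq_deriv_mul (A := ℂ) (a := 0) (b := 0 + ℓ)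
    (fun s _ => hasDerivAt_fourier_neg ℓ n s) (fun s _ => hv.hasDerivAt s)
    (Continuous.intervalIntegrable (by fun_prop) _ _)
    (Continuous.intervalIntegrable
      (hv.circleDeriv.continuous.comp (AddCircle.continuous_mk' ℓ)) _ _)
  simp only [smul_eq_mul]
  rw [h]
  have h0 : ((0 + ℓ : ℝ) : AddCircle ℓ) = ((0 : ℝ) : AddCircle ℓ) := by simp
  rw [h0, sub_self, zero_sub, ← intervalIntegral.integral_neg]
  simp only [Complex.real_smul]
  simp only [← intervalIntegral.integral_const_mul]
  refine intervalIntegral.integral_congr fun s _ => ?_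
  ring

end Smooth

/-! ### The space `L²(κ ds)` -/

section Weight

variable {ℓ : ℝ} [hℓ : Fact (0 < ℓ)] {κ : AddCircle ℓ → ℝ}

theorem isFiniteMeasure_weight (hκ : Continuous κ) : IsFiniteMeasure (weight κ) := by
  obtain ⟨C, hC⟩ := (isCompact_range hκ).bddAbove
  refine isFiniteMeasure_withDensity (ne_top_of_le_ne_top ?_
    (lintegral_mono (g := fun _ => ENNReal.ofReal C) fun s =>
      ENNReal.ofReal_le_ofReal (hC ⟨s, rfl⟩)))
  rw [lintegral_const]
  finiteness

theorem integral_weight {E : Type*} [NormedAddCommGroup E] [NormedSpace ℝ E]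
    (hκ : Continuous κ) (hpos : ∀ s, 0 < κ s) (g : AddCircle ℓ → E) :
    ∫ s, g s ∂(weight κ) = ∫ s, κ s • g s := by
  rw [weight, integral_withDensity_eq_integral_toReal_smul hκ.measurable.ennreal_ofReal (by simp)]
  exact integral_congr_ae (.of_forall fun s => by simp [ENNReal.toReal_ofReal (hpos s).le])

variable (κ) [IsFiniteMeasure (weight κ)]

/-- The class in `L²(κ ds)` of a continuous function. -/
noncomputable def toL2 : C(AddCircle ℓ, ℂ) →L[ℂ] Lp ℂ 2 (weight κ) :=
  ContinuousMap.toLp (E := ℂ) 2 (weight κ) ℂ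

theorem coeFn_toL2 (f : C(AddCircle ℓ, ℂ)) : toL2 κ f =ᵐ[weight κ] f :=
  ContinuousMap.coeFn_toLp (p := 2) (𝕜 := ℂ) (weight κ) f

variable {κ}

theorem inner_toL2 (hκ : Continuous κ) (hpos : ∀ s, 0 < κ s) (f g : C(AddCircle ℓ, ℂ)) :
    inner ℂ (toL2 κ f) (toL2 κ g) = ∫ s, (κ s : ℂ) * (g s * (starRingEnd ℂ) (f s)) := by
  rw [toL2, ContinuousMap.inner_toLp, integral_weight hκ hpos]
  simp only [Complex.real_smul]

theorem norm_sq_toL2 (hκ : Continuous κ) (hpos : ∀ s, 0 < κ s) {f : C(AddCircle ℓ, ℂ)}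
    (hf : ∀ s, ‖f s‖ = 1) : ‖toL2 κ f‖ ^ 2 = ∫ s, κ s := by
  have h := inner_toL2 hκ hpos f f
  simp only [Complex.mul_conj', hf, inner_self_eq_norm_sq_to_K] at h
  simp only [Complex.ofReal_one, one_pow, mul_one, integral_complex_ofReal,
    Complex.coe_algebraMap] at h
  exact_mod_cast h

theorem toL2_injective (hκ : Continuous κ) (hpos : ∀ s, 0 < κ s) {f g : C(AddCircle ℓ, ℂ)}
    (h : toL2 κ f = toL2 κ g) : f = g := by
  have hac : (volume : Measure (AddCircle ℓ)) ≪ weight κ :=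
    withDensity_absolutelyContinuous' (ENNReal.measurable_ofReal.comp hκ.measurable).aemeasurable
      (.of_forall fun s => by simp [hpos s])
  have h1 : f =ᵐ[weight κ] g := (coeFn_toL2 κ f).symm.trans (h ▸ coeFn_toL2 κ g)
  exact DFunLike.coe_injective
    ((Continuous.ae_eq_iff_eq volume f.continuous g.continuous).1 (hac.ae_eq h1))

/-- Multiplying the trigonometric monomials by a nowhere vanishing continuous function gives a
family with dense span. -/
theorem eq_zero_of_inner_mul_fourier_eq_zero {ρ : C(AddCircle ℓ, ℂ)} (hρ : ∀ s, ρ s ≠ 0)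
    {v : Lp ℂ 2 (weight κ)} (hv : ∀ n : ℤ, inner ℂ (toL2 κ (ρ * fourier n)) v = 0) : v = 0 := by
  let Φ : C(AddCircle ℓ, ℂ) →L[ℂ] ℂ :=
    (innerSL ℂ v).comp ((toL2 κ).comp (ContinuousLinearMap.mul ℂ C(AddCircle ℓ, ℂ) ρ))
  have hΦ : Φ = 0 := by
    refine ContinuousLinearMap.ext_on (s := Set.range (@fourier ℓ)) ?_ ?_
    · rw [dense_iff_closure_eq, ← Submodule.topologicalClosure_coe, span_fourier_closure_eq_top,
        Submodule.top_coe]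
    · rintro _ ⟨n, rfl⟩
      exact inner_eq_zero_symm.1 (hv n)
  have hd : DenseRange (toL2 κ) := ContinuousMap.toLp_denseRange ℂ (weight κ) ℂ (by simp)
  refine Dense.eq_zero_of_inner_left ℂ hd ?_
  rintro _ ⟨g, rfl⟩
  let g' : C(AddCircle ℓ, ℂ) := ⟨fun s => (ρ s)⁻¹ * g s,
    (ρ.continuous.inv₀ hρ).mul g.continuous⟩
  have hg : ρ * g' = g := by
    ext s
    simp [g', mul_inv_cancel_left₀ (hρ s)]
  have h1 : inner ℂ v (toL2 κ (ρ * g')) = 0 := DFunLike.congr_fun hΦ g'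
  rwa [hg] at h1

/-! ### The graph of `B` and its Fourier coefficients -/

/-- The elements of the graph of `B` are the pairs of classes of `v` and `-(2κ)⁻¹ v''` with `v`
smooth. -/
theorem mem_graph_operatorB_iff (hκ : Continuous κ) (hpos : ∀ s, 0 < κ s)
    {u f : Lp ℂ 2 (weight κ)} :
    (u, f) ∈ (operatorB κ).graph ↔ ∃ (v : AddCircle ℓ → ℂ) (hv : IsSmooth v),
      u = toL2 κ ⟨v, hv.continuous⟩ ∧ f = toL2 κ (applyB hκ hpos hv) := by
  rw [operatorB_graph hκ hpos]
  constructor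
  · rintro ⟨v, hv, h1, h2⟩
    exact ⟨v, hv, Lp.ext (h1.trans (coeFn_toL2 κ ⟨v, hv.continuous⟩).symm),
      Lp.ext (h2.trans (coeFn_toL2 κ (applyB hκ hpos hv)).symm)⟩
  · rintro ⟨v, hv, rfl, rfl⟩
    exact ⟨v, hv, coeFn_toL2 κ _, coeFn_toL2 κ _⟩

theorem inner_toL2_fourier_applyB (hκ : Continuous κ) (hpos : ∀ s, 0 < κ s) {v : AddCircle ℓ → ℂ}
    (hv : IsSmooth v) (n : ℤ) :
    inner ℂ (toL2 κ (fourier n)) (toL2 κ (applyB hκ hpos hv)) =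
      ((ℓ / 2 * (2 * Real.pi * n / ℓ) ^ 2 : ℝ) : ℂ) * fourierCoeff v n := by
  have hℓ0 : (ℓ : ℂ) ≠ 0 := Complex.ofReal_ne_zero.2 hℓ.out.ne'
  have h1 : fourierCoeff (circleDeriv (circleDeriv v)) n =
      (ℓ : ℂ)⁻¹ * ∫ s, fourier (-n) s * circleDeriv (circleDeriv v) s := by
    rw [fourierCoeff, AddCircle.integral_haarAddCircle, Complex.real_smul, Complex.ofReal_inv]
    rfl
  rw [fourierCoeff_circleDeriv hv.circleDeriv, fourierCoeff_circleDeriv hv] at h1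
  have h2 : ∫ s, fourier (-n) s * circleDeriv (circleDeriv v) s =
      (ℓ : ℂ) * ((2 * Real.pi * Complex.I * n / ℓ) *
        ((2 * Real.pi * Complex.I * n / ℓ) * fourierCoeff v n)) := by
    rw [h1, mul_inv_cancel_left₀ hℓ0]
  have h3 : ∀ s, (κ s : ℂ) * (applyB hκ hpos hv s * (starRingEnd ℂ) (fourier n s)) =
      -(1 / 2) * (fourier (-n) s * circleDeriv (circleDeriv v) s) := fun s => by
    rw [← mul_assoc, mul_applyB, fourier_neg]
    ring
  rw [inner_toL2 hκ hpos]
  simp only [h3]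
  rw [integral_const_mul, h2]
  push_cast
  ring_nf
  simp only [Complex.I_sq]
  ring

theorem norm_toL2_fourier_le (n : ℤ) :
    ‖toL2 κ (fourier n)‖ ≤ ‖toL2 κ‖ := by
  simpa [fourier_norm] using (toL2 κ).le_opNorm (fourier n)

end Weight

/-! ### The reduced inverse of `B` -/

section Green

variable {ℓ : ℝ} [hℓ : Fact (0 < ℓ)] {κ : AddCircle ℓ → ℝ}

/-- The ratio `(ℓ/2) (2πn/ℓ)²` of `⟪eₙ, B v⟫`, taken in `L²(κ ds)`, to the `n`-th Fourier
coefficient of `v`. The Fourier coefficients refer to the measure of total mass one, which accounts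
for the factor `ℓ`. -/
noncomputable def fourierRatio (ℓ : ℝ) (n : ℤ) : ℝ := ℓ / 2 * (2 * Real.pi * n / ℓ) ^ 2

theorem fourierRatio_nonneg (n : ℤ) : 0 ≤ fourierRatio ℓ n := by
  have := hℓ.out
  unfold fourierRatio
  positivity

theorem fourierRatio_ne_zero {n : ℤ} (hn : n ≠ 0) : fourierRatio ℓ n ≠ 0 := by
  have := hℓ.out
  unfold fourierRatio
  positivity

omit hℓ in
theorem fourierRatio_zero : fourierRatio ℓ 0 = 0 := by simp [fourierRatio]

theorem summable_inv_fourierRatio : Summable fun n : ℤ => (fourierRatio ℓ n)⁻¹ := by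
  have h := (Real.summable_one_div_int_pow (p := 2)).2 one_lt_two
  refine (h.mul_left (ℓ / (2 * Real.pi ^ 2))).congr fun n => ?_
  have := hℓ.out.ne'
  unfold fourierRatio
  by_cases hn : (n : ℝ) = 0
  · simp [hn]
  · field_simp

/-- The Fourier coefficients of a smooth function are `O(n⁻²)`, by two integrations by parts. -/
theorem summable_fourierCoeff {v : AddCircle ℓ → ℂ} (hv : IsSmooth v) :
    Summable (fourierCoeff v) := by
  let C := ∫ s, ‖circleDeriv (circleDeriv v) s‖ ∂(AddCircle.haarAddCircle (T := ℓ))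
  have hC : ∀ n, ‖fourierCoeff (circleDeriv (circleDeriv v)) n‖ ≤ C := fun n => by
    refine (norm_integral_le_integral_norm _).trans_eq (integral_congr_ae (.of_forall fun s => ?_))
    simp only [smul_eq_mul, norm_mul, Circle.norm_coe, fourier_apply, one_mul]
  refine Summable.of_norm_bounded_eventually
    ((summable_inv_fourierRatio (ℓ := ℓ)).mul_left (ℓ / 2 * C)) ?_
  filter_upwards [(Set.finite_singleton (0 : ℤ)).compl_mem_cofinite] with n hn
  have hn : n ≠ 0 := hn
  have hr := (fourierRatio_nonneg (ℓ := ℓ) n).lt_of_ne' (fourierRatio_ne_zero hn)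
  have h1 := hC n
  rw [fourierCoeff_circleDeriv hv.circleDeriv, fourierCoeff_circleDeriv hv] at h1
  have h2 : ‖(2 * Real.pi * Complex.I * n / ℓ : ℂ)‖ ^ 2 = (2 * Real.pi * n / ℓ) ^ 2 := by
    simp [mul_pow, div_pow]
  rw [norm_mul, norm_mul, ← mul_assoc, ← sq, h2] at h1
  rw [← div_eq_mul_inv, le_div_iff₀ hr, mul_comm, fourierRatio, mul_assoc]
  have := hℓ.out
  gcongr

variable [IsFiniteMeasure (weight κ)]

variable (κ) in
/-- The Green operator `∑ (ℓ/2)⁻¹ (2πn/ℓ)⁻² ⟪eₙ, ·⟫ eₙ`, where `eₙ` are the trigonometric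
monomials and the term `n = 0` is absent because `0⁻¹ = 0`. -/
noncomputable def green : Lp ℂ 2 (weight κ) →L[ℂ] Lp ℂ 2 (weight κ) :=
  ∑' n : ℤ, (((fourierRatio ℓ n)⁻¹ : ℝ) : ℂ) •
    InnerProductSpace.rankOne ℂ (toL2 κ (fourier n)) (toL2 κ (fourier n))

variable (κ) in
theorem hasSum_green : HasSum (fun n : ℤ => (((fourierRatio ℓ n)⁻¹ : ℝ) : ℂ) •
    InnerProductSpace.rankOne ℂ (toL2 κ (fourier n)) (toL2 κ (fourier n))) (green κ) := by
  refine Summable.hasSum (Summable.of_norm_bounded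
    ((summable_inv_fourierRatio (ℓ := ℓ)).mul_right (‖toL2 κ‖ * ‖toL2 κ‖)) fun n => ?_)
  rw [norm_smul, InnerProductSpace.norm_rankOne, Complex.norm_real,
    Real.norm_of_nonneg (inv_nonneg.2 (fourierRatio_nonneg n))]
  have := inv_nonneg.2 (fourierRatio_nonneg (ℓ := ℓ) n)
  gcongr <;> exact norm_toL2_fourier_le n

theorem hasSum_green_apply (x : Lp ℂ 2 (weight κ)) :
    HasSum (fun n : ℤ => ((((fourierRatio ℓ n)⁻¹ : ℝ) : ℂ) * inner ℂ (toL2 κ (fourier n)) x) •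
      toL2 κ (fourier n)) (green κ x) := by
  have h := (ContinuousLinearMap.apply ℂ (Lp ℂ 2 (weight κ)) x).hasSum (hasSum_green κ)
  simpa only [ContinuousLinearMap.apply_apply, FunLike.coe_smul, Pi.smul_apply,
    InnerProductSpace.rankOne_apply, smul_smul, Function.comp_def] using h

variable (κ) in
theorem isCompactOperator_green : IsCompactOperator (green κ) := by
  refine isCompactOperator_of_tendsto (hasSum_green κ) (.of_forall fun t => ?_)
  refine (compactOperator (RingHom.id ℂ) (Lp ℂ 2 (weight κ)) (Lp ℂ 2 (weight κ))).sum_mem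
    fun n _ => Submodule.smul_mem _ _ ?_
  exact (isCompactOperator_of_locallyCompactSpace_dom
    (innerSL ℂ (toL2 κ (fourier n)))).clm_comp
      (ContinuousLinearMap.toSpanSingleton ℂ (toL2 κ (fourier n)))

theorem hasSum_inner_green (x y : Lp ℂ 2 (weight κ)) :
    HasSum (fun n : ℤ => (((fourierRatio ℓ n)⁻¹ : ℝ) : ℂ) *
      (inner ℂ x (toL2 κ (fourier n)) * inner ℂ (toL2 κ (fourier n)) y))
      (inner ℂ x (green κ y)) := by
  refine ((innerSL ℂ x).hasSum (hasSum_green_apply y)).congr_fun fun n => ?_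
  simp only [innerSL_apply_apply, inner_smul_right]
  ring

variable (κ) in
theorem isPositive_green : (green κ).IsPositive := by
  rw [ContinuousLinearMap.isPositive_iff]
  constructor
  · intro x y
    have h := Complex.hasSum_conj'.2 (hasSum_inner_green y x)
    simp only [map_mul, inner_conj_symm, Complex.conj_ofReal] at h
    refine h.unique ((hasSum_inner_green x y).congr_fun fun n => ?_)
    ring
  · intro x
    rw [← inner_conj_symm]
    refine (Complex.hasSum_conj'.2 (hasSum_inner_green x x)).nonneg fun n => ?_
    rw [map_mul, Complex.conj_ofReal, ← inner_conj_symm x, ← Complex.normSq_eq_conj_mul_self,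
      Complex.conj_ofReal, ← Complex.ofReal_mul]
    exact Complex.zero_le_real.2 (mul_nonneg (inv_nonneg.2 (fourierRatio_nonneg n))
      (Complex.normSq_nonneg _))

/-- Up to a constant, the Green operator inverts `B` on smooth functions: this is the uniform
convergence of the Fourier series. -/
theorem green_applyB (hκ : Continuous κ) (hpos : ∀ s, 0 < κ s) {v : AddCircle ℓ → ℂ}
    (hv : IsSmooth v) : green κ (toL2 κ (applyB hκ hpos hv)) =
      toL2 κ ⟨v, hv.continuous⟩ - fourierCoeff v 0 • toL2 κ 1 := by
  have h1 := hasSum_green_apply (toL2 κ (applyB hκ hpos hv))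
  have h2 := (toL2 κ).hasSum (hasSum_fourier_series_of_summable
    (f := ⟨v, hv.continuous⟩) (summable_fourierCoeff hv))
  have h3 := h2.update 0 0
  have h4 : (fun n : ℤ => ((((fourierRatio ℓ n)⁻¹ : ℝ) : ℂ) *
      inner ℂ (toL2 κ (fourier n)) (toL2 κ (applyB hκ hpos hv))) • toL2 κ (fourier n)) =
      Function.update (fun n : ℤ => toL2 κ (fourierCoeff v n • fourier n)) 0 0 := by
    funext n
    rcases eq_or_ne n 0 with rfl | hn
    · simp [fourierRatio_zero]
    · rw [Function.update_of_ne hn, inner_toL2_fourier_applyB, ← fourierRatio, map_smul,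
        ← mul_assoc, Complex.ofReal_inv, inv_mul_cancel₀ (by exact_mod_cast fourierRatio_ne_zero hn), one_mul]
  have h5 : (fourier 0 : C(AddCircle ℓ, ℂ)) = 1 := by ext; simp
  rw [h4] at h1
  have h6 := h1.unique h3
  rw [h6, ContinuousMap.coe_mk, map_smul, h5]
  abel

variable (κ) in
/-- The Green operator compressed to the orthogonal complement of the constants. -/
noncomputable def reducedGreen : Lp ℂ 2 (weight κ) →L[ℂ] Lp ℂ 2 (weight κ) :=
  (Submodule.span ℂ {toL2 κ 1})ᗮ.starProjection ∘L green κ ∘L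
    (Submodule.span ℂ {toL2 κ 1})ᗮ.starProjection

theorem isReducedInverse_reducedGreen (hκ : Continuous κ) (hpos : ∀ s, 0 < κ s) :
    IsReducedInverse (operatorB κ) (toL2 κ 1) (reducedGreen κ) := by
  have h0 : (fourier 0 : C(AddCircle ℓ, ℂ)) = 1 := by ext; simp
  have hP : (Submodule.span ℂ {toL2 κ 1})ᗮ.starProjection (toL2 κ 1) = 0 :=
    Submodule.starProjection_orthogonalComplement_singleton_eq_zero (𝕜 := ℂ) (toL2 κ 1)
  have horth : ∀ {v : AddCircle ℓ → ℂ} (hv : IsSmooth v),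
      inner ℂ (toL2 κ 1) (toL2 κ (applyB hκ hpos hv)) = 0 := fun hv => by
    rw [← h0, inner_toL2_fourier_applyB]
    simp
  refine
    { compact := ((isCompactOperator_green κ).comp_clm
        (Submodule.span ℂ {toL2 κ 1})ᗮ.starProjection).clm_comp
          (Submodule.span ℂ {toL2 κ 1})ᗮ.starProjection
      positive := (isPositive_green κ).conj_starProjection _
      dense := ?_
      ne_zero := ?_
      apply_self := by simp only [reducedGreen, ContinuousLinearMap.comp_apply, hP, map_zero]
      mem_graph := ?_
      inner_eq_zero := ?_
      left_inv := ?_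
      mem_span := ?_ }
  · rw [Submodule.dense_iff_topologicalClosure_eq_top, Submodule.topologicalClosure_eq_top_iff,
      Submodule.eq_bot_iff]
    intro v hv
    refine eq_zero_of_inner_mul_fourier_eq_zero (ρ := 1) (by simp) fun n => ?_
    rw [one_mul]
    refine (Submodule.mem_orthogonal _ _).1 hv _ ?_
    exact LinearPMap.mem_domain_of_mem_graph ((mem_graph_operatorB_iff hκ hpos).2
      ⟨fourier n, IsSmooth.of_fourier n, rfl, rfl⟩)
  · intro h
    have h1 := toL2_injective hκ hpos (h.trans (map_zero (toL2 κ)).symm)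
    exact one_ne_zero (DFunLike.congr_fun h1 0)
  · refine (mem_graph_operatorB_iff hκ hpos).2 ⟨fun _ => 1, IsSmooth.of_const 1, rfl, ?_⟩
    rw [← map_zero (toL2 κ)]
    congr 1
    ext s
    simp [applyB, circleDeriv]
  · intro u f hf
    obtain ⟨v, hv, -, rfl⟩ := (mem_graph_operatorB_iff hκ hpos).1 hf
    exact horth hv
  · intro u f hf
    obtain ⟨v, hv, rfl, rfl⟩ := (mem_graph_operatorB_iff hκ hpos).1 hf
    have h1 : (Submodule.span ℂ {toL2 κ 1})ᗮ.starProjection (toL2 κ (applyB hκ hpos hv)) =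
        toL2 κ (applyB hκ hpos hv) :=
      Submodule.starProjection_eq_self_iff.2
        (Submodule.mem_orthogonal_singleton_iff_inner_right.2 (horth hv))
    obtain ⟨c, hc⟩ := Submodule.mem_span_singleton.1
      (Submodule.starProjection_apply_mem (Submodule.span ℂ {toL2 κ 1}) (toL2 κ ⟨v, hv.continuous⟩))
    refine ⟨c, ?_⟩
    rw [reducedGreen, ContinuousLinearMap.comp_apply, ContinuousLinearMap.comp_apply, h1,
      green_applyB, map_sub, map_smul, hP, smul_zero, sub_zero,
      Submodule.starProjection_orthogonal_val, hc]
    abel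
  · intro v hv
    -- `κ⁻¹ eₙ` is a multiple of `B eₙ` for `n ≠ 0`; the multiple `c` of `1` takes care of `n = 0`
    let ρ : C(AddCircle ℓ, ℂ) := ⟨fun s => (κ s : ℂ)⁻¹,
      (Complex.continuous_ofReal.comp hκ).inv₀ fun s => Complex.ofReal_ne_zero.2 (hpos s).ne'⟩
    have hρ : ∀ n : ℤ, inner ℂ (toL2 κ (ρ * fourier n)) (toL2 κ 1) =
        ∫ s : AddCircle ℓ, fourier (-n) s := by
      intro n
      rw [inner_toL2 hκ hpos]
      refine integral_congr_ae (.of_forall fun s => ?_)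
      have h : (κ s : ℂ) ≠ 0 := Complex.ofReal_ne_zero.2 (hpos s).ne'
      simp [ρ, mul_inv_cancel_left₀ h]
    have hB : ∀ n : ℤ, n ≠ 0 → ∀ w : Lp ℂ 2 (weight κ), inner ℂ (toL2 κ (applyB hκ hpos
        (IsSmooth.of_fourier n))) w = 0 → inner ℂ (toL2 κ (ρ * fourier n)) w = 0 := by
      intro n hn w hw
      have h1 : applyB hκ hpos (IsSmooth.of_fourier n) =
          (((2 * Real.pi * n / ℓ) ^ 2 / 2 : ℝ) : ℂ) • (ρ * fourier n) := by
        ext s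
        exact applyB_fourier hκ hpos n s
      rw [h1, map_smul, inner_smul_left] at hw
      refine (mul_eq_zero.1 hw).resolve_left ?_
      rw [Complex.conj_ofReal, Complex.ofReal_eq_zero, ← ne_eq]
      have := hℓ.out.ne'
      positivity
    have hρ0 : inner ℂ (toL2 κ (ρ * fourier 0)) (toL2 κ 1) ≠ 0 := by
      rw [hρ]
      have hvol : volume.real (Set.univ : Set (AddCircle ℓ)) = ℓ := by
        rw [Measure.real, AddCircle.measure_univ, ENNReal.toReal_ofReal hℓ.out.le]
      simp [hvol, hℓ.out.ne']
    refine ⟨inner ℂ (toL2 κ (ρ * fourier 0)) v / inner ℂ (toL2 κ (ρ * fourier 0)) (toL2 κ 1), ?_⟩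
    rw [← sub_eq_zero]
    refine eq_zero_of_inner_mul_fourier_eq_zero (ρ := ρ)
      (fun s => inv_ne_zero (Complex.ofReal_ne_zero.2 (hpos s).ne')) fun n => ?_
    rcases eq_or_ne n 0 with rfl | hn
    · rw [inner_sub_right, inner_smul_right, div_mul_cancel₀ _ hρ0, sub_self]
    · refine hB n hn _ ?_
      rw [inner_sub_right, inner_smul_right, inner_eq_zero_symm.1 (horth _), mul_zero, sub_zero]
      exact hv _ _ ((mem_graph_operatorB_iff hκ hpos).2
        ⟨fourier n, IsSmooth.of_fourier n, rfl, rfl⟩)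

end Green

/-! ### Arc-length parametrized curves in complex notation -/

section Curve

theorem integral_circleDeriv {ℓ : ℝ} [Fact (0 < ℓ)] {E : Type*} [NormedAddCommGroup E]
    [NormedSpace ℝ E] [CompleteSpace E] {f : AddCircle ℓ → E} (hf : IsSmooth f) :
    ∫ s, circleDeriv f s = 0 := by
  rw [← AddCircle.intervalIntegral_preimage ℓ 0,
    intervalIntegral.integral_eq_sub_of_hasDerivAt (fun s _ => hf.hasDerivAt s)
      (Continuous.intervalIntegrable
        (hf.circleDeriv.continuous.comp (AddCircle.continuous_mk' ℓ)) _ _)]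
  rw [zero_add, AddCircle.coe_period, AddCircle.coe_zero, sub_self]

variable {ℓ : ℝ} {γ : AddCircle ℓ → EuclideanSpace ℝ (Fin 2)}

/-- The curve `ξ + iη` in the complex plane. -/
noncomputable def complexCurve (γ : AddCircle ℓ → EuclideanSpace ℝ (Fin 2)) (s : AddCircle ℓ) : ℂ :=
  Complex.orthonormalBasisOneI.repr.symm (γ s)

/-- The unit tangent `ξ' + iη'`. -/
noncomputable def tangent (γ : AddCircle ℓ → EuclideanSpace ℝ (Fin 2)) : AddCircle ℓ → ℂ :=
  circleDeriv (complexCurve γ)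

theorem isSmooth_complexCurve (hγ : IsSmooth γ) : IsSmooth (complexCurve γ) :=
  Complex.orthonormalBasisOneI.repr.symm.contDiff.comp hγ

theorem circleDeriv_complexCurve (hγ : IsSmooth γ) :
    circleDeriv (complexCurve γ) = complexCurve (circleDeriv γ) :=
  circleDeriv_eq_of_hasDerivAt fun s =>
    (Complex.orthonormalBasisOneI.repr.symm : EuclideanSpace ℝ (Fin 2) ≃L[ℝ] ℂ).hasFDerivAt
      |>.comp_hasDerivAt s (hγ.hasDerivAt s)

theorem isSmooth_tangent (hγ : IsSmooth γ) : IsSmooth (tangent γ) :=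
  (isSmooth_complexCurve hγ).circleDeriv

theorem norm_tangent (hγ : IsSmoothSimpleClosedArcLength γ) (s : AddCircle ℓ) :
    ‖tangent γ s‖ = 1 := by
  rw [tangent, circleDeriv_complexCurve hγ.smooth, complexCurve, LinearIsometryEquiv.norm_map,
    hγ.arcLength]

theorem curvature_eq_im (hγ : IsSmooth γ) (s : AddCircle ℓ) :
    curvature γ s = ((starRingEnd ℂ) (tangent γ s) * circleDeriv (tangent γ) s).im := by
  rw [tangent, circleDeriv_complexCurve hγ, circleDeriv_complexCurve hγ.circleDeriv]
  simp [complexCurve, curvature, Complex.orthonormalBasisOneI_repr_symm_apply]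
  ring

theorem isSmooth_curvature (hγ : IsSmooth γ) : IsSmooth (curvature γ) := by
  rw [funext (curvature_eq_im hγ)]
  have h := (isSmooth_tangent hγ)
  exact Complex.imCLM.contDiff.comp
    ((Complex.conjCLE.contDiff.comp h).mul h.circleDeriv)

/-- The Frenet equation `τ' = iκτ`. -/
theorem circleDeriv_tangent (hγ : IsSmoothSimpleClosedArcLength γ) (s : AddCircle ℓ) :
    circleDeriv (tangent γ) s = Complex.I * curvature γ s * tangent γ s := by
  have hn : ∀ s, (starRingEnd ℂ) (tangent γ s) * tangent γ s = 1 := fun s => by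
    rw [Complex.conj_mul', norm_tangent hγ]
    simp
  -- `‖τ‖² = 1` forces `τ̄ τ'` to be purely imaginary
  have hre : ((starRingEnd ℂ) (tangent γ s) * circleDeriv (tangent γ) s).re = 0 := by
    induction s using QuotientAddGroup.induction_on with
    | H s =>
      have h1 := (isSmooth_tangent hγ.smooth).hasDerivAt s
      have h2 := (Complex.conjCLE.toContinuousLinearMap.hasFDerivAt.comp_hasDerivAt s h1).mul h1
      have h3 : HasDerivAt (fun t : ℝ => (1 : ℂ)) _ s := h2.congr_of_eventuallyEq
        (.of_forall fun t => (hn t).symm)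
      have h4 := congrArg Complex.re (h3.unique (hasDerivAt_const s 1))
      simp at h4
      simp
      linarith
  have h1 : (starRingEnd ℂ) (tangent γ s) * circleDeriv (tangent γ) s =
      Complex.I * curvature γ s := by
    refine Complex.ext ?_ ?_
    · rw [hre]; simp
    · rw [← curvature_eq_im hγ.smooth]; simp
  rw [← h1, mul_right_comm, hn, one_mul]

theorem circleDeriv_circleDeriv_tangent (hγ : IsSmoothSimpleClosedArcLength γ) (s : AddCircle ℓ) :
    circleDeriv (circleDeriv (tangent γ)) s =
      (Complex.I * circleDeriv (curvature γ) s - (curvature γ s : ℂ) ^ 2) * tangent γ s := by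
  have h : circleDeriv (circleDeriv (tangent γ)) = fun s =>
      (Complex.I * circleDeriv (curvature γ) s - (curvature γ s : ℂ) ^ 2) * tangent γ s := by
    refine circleDeriv_eq_of_hasDerivAt fun s => ?_
    have h1 := (isSmooth_tangent hγ.smooth).hasDerivAt s
    have h2 := ((isSmooth_curvature hγ.smooth).hasDerivAt s).ofReal_comp
    simp only [circleDeriv_tangent hγ] at h1 ⊢
    refine ((h2.const_mul Complex.I).mul h1).congr_deriv ?_
    linear_combination ((curvature γ s : ℂ) ^ 2 * tangent γ s) * Complex.I_sq
  exact congrFun h s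

/-- Integrated Frenet equation. -/
theorem tangent_eq_exp (hγ : IsSmoothSimpleClosedArcLength γ) (s : ℝ) :
    tangent γ (s : AddCircle ℓ) = tangent γ ((0 : ℝ) : AddCircle ℓ) *
      Complex.exp (Complex.I * (∫ t in (0 : ℝ)..s, curvature γ (t : AddCircle ℓ) : ℝ)) := by
  let θ : ℝ → ℝ := fun s => ∫ t in (0 : ℝ)..s, curvature γ (t : AddCircle ℓ)
  have hc : Continuous fun t : ℝ => curvature γ (t : AddCircle ℓ) :=
    (isSmooth_curvature hγ.smooth).continuous.comp (AddCircle.continuous_mk' ℓ)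
  have hθ : ∀ s : ℝ, HasDerivAt θ (curvature γ (s : AddCircle ℓ)) s := fun s =>
    intervalIntegral.integral_hasDerivAt_right (hc.intervalIntegrable _ _)
      (hc.stronglyMeasurableAtFilter _ _) hc.continuousAt
  have hd : ∀ s : ℝ, HasDerivAt (fun s : ℝ => tangent γ (s : AddCircle ℓ) *
      Complex.exp (-(Complex.I * θ s))) 0 s := fun s => by
    have h1 := (isSmooth_tangent hγ.smooth).hasDerivAt s
    have h2 := ((hθ s).ofReal_comp.const_mul Complex.I).neg.cexp
    refine (h1.mul h2).congr_deriv ?_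
    rw [circleDeriv_tangent hγ]
    ring
  have h3 := is_const_of_deriv_eq_zero (fun s => (hd s).differentiableAt)
    (fun s => (hd s).deriv) s 0
  have h0 : θ 0 = 0 := intervalIntegral.integral_same
  simp only [h0, Complex.ofReal_zero, mul_zero, neg_zero, Complex.exp_zero, mul_one] at h3
  rw [← h3, mul_assoc, ← Complex.exp_add, neg_add_cancel, Complex.exp_zero, mul_one]

/-- The total curvature of a closed curve of positive curvature is a positive multiple of `2π`,
because the tangent is periodic. -/
theorem two_pi_le_integral_curvature [hℓ : Fact (0 < ℓ)] (hγ : IsSmoothSimpleClosedArcLength γ)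
    (hκ : ∀ s, 0 < curvature γ s) : 2 * Real.pi ≤ ∫ s, curvature γ s := by
  have hc : Continuous fun t : ℝ => curvature γ (t : AddCircle ℓ) :=
    (isSmooth_curvature hγ.smooth).continuous.comp (AddCircle.continuous_mk' ℓ)
  have h1 := tangent_eq_exp hγ (0 + ℓ)
  have h0 : ((0 + ℓ : ℝ) : AddCircle ℓ) = ((0 : ℝ) : AddCircle ℓ) := by simp
  have hτ : tangent γ ((0 : ℝ) : AddCircle ℓ) ≠ 0 :=
    norm_ne_zero_iff.1 (by rw [norm_tangent hγ]; exact one_ne_zero)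
  have hpos : 0 < ∫ t in (0 : ℝ)..(0 + ℓ), curvature γ (t : AddCircle ℓ) :=
    intervalIntegral.intervalIntegral_pos_of_pos_on (hc.intervalIntegrable _ _)
      (fun s _ => hκ s) (by simpa using hℓ.out)
  rw [AddCircle.intervalIntegral_preimage ℓ 0 (curvature γ)] at h1 hpos
  rw [h0] at h1
  obtain ⟨n, hn⟩ := Complex.exp_eq_one_iff.1 (mul_left_cancel₀ hτ (h1.symm.trans (mul_one _).symm))
  have h2 : ∫ s, curvature γ s = n * (2 * Real.pi) := by
    have h3 : Complex.I * ((∫ s, curvature γ s : ℝ) : ℂ) =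
        Complex.I * ((n * (2 * Real.pi) : ℝ) : ℂ) := by
      rw [hn]
      push_cast
      ring
    exact_mod_cast mul_left_cancel₀ Complex.I_ne_zero h3
  rw [h2] at hpos ⊢
  have hn1 : (0 : ℝ) < n := pos_of_mul_pos_left hpos Real.two_pi_pos.le
  have hn2 : (1 : ℝ) ≤ n := by exact_mod_cast hn1
  nlinarith [Real.two_pi_pos]

/-! ### Curves of constant curvature -/

theorem tangent_eq_exp_of_curvature_eq (hγ : IsSmoothSimpleClosedArcLength γ) {c : ℝ}
    (hc : ∀ s, curvature γ s = c) (s : ℝ) :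
    tangent γ (s : AddCircle ℓ) = tangent γ ((0 : ℝ) : AddCircle ℓ) *
      Complex.exp (((c * s : ℝ) : ℂ) * Complex.I) := by
  rw [tangent_eq_exp hγ s]
  simp [hc, mul_comm]

/-- A curve of constant curvature `c` has the centre `ζ + (i / c) τ`. -/
theorem exists_complexCurve_eq (hγ : IsSmoothSimpleClosedArcLength γ) {c : ℝ} (hc0 : c ≠ 0)
    (hc : ∀ s, curvature γ s = c) :
    ∃ z : ℂ, ∀ s : ℝ, complexCurve γ (s : AddCircle ℓ) =
      z + tangent γ (s : AddCircle ℓ) / (Complex.I * c) := by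
  have hc0' : (c : ℂ) ≠ 0 := Complex.ofReal_ne_zero.2 hc0
  have hd : ∀ s : ℝ, HasDerivAt (fun s : ℝ => complexCurve γ (s : AddCircle ℓ) -
      tangent γ (s : AddCircle ℓ) / (Complex.I * c)) 0 s := fun s => by
    refine (((isSmooth_complexCurve hγ.smooth).hasDerivAt s).sub
      (((isSmooth_tangent hγ.smooth).hasDerivAt s).div_const _)).congr_deriv ?_
    rw [circleDeriv_tangent hγ, hc, mul_div_cancel_left₀ _ (mul_ne_zero Complex.I_ne_zero hc0'),
      tangent, sub_self]
  exact ⟨_, fun s => sub_eq_iff_eq_add.1 (is_const_of_deriv_eq_zero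
    (fun s => (hd s).differentiableAt) (fun s => (hd s).deriv) s 0)⟩

/-- A simple closed curve of constant curvature `c` goes around its circle once only. -/
theorem mul_length_eq_two_pi [hℓ : Fact (0 < ℓ)] (hγ : IsSmoothSimpleClosedArcLength γ) {c : ℝ}
    (hc0 : 0 < c) (hc : ∀ s, curvature γ s = c) : c * ℓ = 2 * Real.pi := by
  refine le_antisymm ?_ ?_
  · obtain ⟨z, hz⟩ := exists_complexCurve_eq hγ hc0.ne' hc
    have h1 : tangent γ ((2 * Real.pi / c : ℝ) : AddCircle ℓ) =
        tangent γ ((0 : ℝ) : AddCircle ℓ) := by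
      rw [tangent_eq_exp_of_curvature_eq hγ hc, mul_div_cancel₀ _ hc0.ne']
      push_cast
      rw [Complex.exp_two_pi_mul_I, mul_one]
    have h2 : complexCurve γ ((2 * Real.pi / c : ℝ) : AddCircle ℓ) =
        complexCurve γ ((0 : ℝ) : AddCircle ℓ) := by rw [hz, hz, h1]
    have h3 := hγ.simple (Complex.orthonormalBasisOneI.repr.symm.injective h2)
    rw [AddCircle.coe_zero, AddCircle.coe_eq_zero_iff] at h3
    obtain ⟨n, hn⟩ := h3
    rw [zsmul_eq_mul, eq_div_iff hc0.ne'] at hn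
    have hn1 : (0 : ℝ) < n := by
      have h4 : 0 < (n : ℝ) * (ℓ * c) := by
        rw [← mul_assoc, hn]
        exact Real.two_pi_pos
      exact pos_of_mul_pos_left h4 (mul_pos hℓ.out hc0).le
    have hn2 : (1 : ℝ) ≤ n := by exact_mod_cast hn1
    nlinarith [mul_pos hℓ.out hc0]
  · have h1 := two_pi_le_integral_curvature hγ fun s => by rw [hc]; exact hc0
    simpa [hc, Measure.real, AddCircle.measure_univ, hℓ.out.le, mul_comm] using h1

theorem exists_range_eq_sphere (hγ : IsSmoothSimpleClosedArcLength γ) {c : ℝ}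
    (hc0 : 0 < c) (hc : ∀ s, curvature γ s = c) :
    ∃ z : EuclideanSpace ℝ (Fin 2), Set.range γ = Metric.sphere z (1 / c) := by
  obtain ⟨z, hz⟩ := exists_complexCurve_eq hγ hc0.ne' hc
  have hc0' : (c : ℂ) ≠ 0 := Complex.ofReal_ne_zero.2 hc0.ne'
  have hτ := norm_tangent hγ ((0 : ℝ) : AddCircle ℓ)
  have hτ0 : tangent γ ((0 : ℝ) : AddCircle ℓ) ≠ 0 :=
    norm_ne_zero_iff.1 (by rw [hτ]; exact one_ne_zero)
  refine ⟨Complex.orthonormalBasisOneI.repr z, Set.Subset.antisymm ?_ fun w hw => ?_⟩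
  · rintro _ ⟨x, rfl⟩
    induction x using QuotientAddGroup.induction_on with
    | H s =>
      rw [mem_sphere_iff_norm, ← Complex.orthonormalBasisOneI.repr.symm.norm_map, map_sub,
        LinearIsometryEquiv.symm_apply_apply]
      change ‖complexCurve γ (s : AddCircle ℓ) - z‖ = _
      rw [hz, add_sub_cancel_left, norm_div, norm_tangent hγ]
      simp [abs_of_pos hc0]
  · rw [mem_sphere_iff_norm, ← Complex.orthonormalBasisOneI.repr.symm.norm_map, map_sub,
        LinearIsometryEquiv.symm_apply_apply] at hw
    -- the parameter is read off from the tangent at the given point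
    set q : ℂ := Complex.orthonormalBasisOneI.repr.symm w - z with hq
    have h1 : ‖q * (Complex.I * c) / tangent γ ((0 : ℝ) : AddCircle ℓ)‖ = 1 := by
      rw [norm_div, norm_mul, hw, hτ]
      simp [abs_of_pos hc0, hc0.ne']
    obtain ⟨φ, hφ⟩ := (Complex.norm_eq_one_iff _).1 h1
    refine ⟨((φ / c : ℝ) : AddCircle ℓ), Complex.orthonormalBasisOneI.repr.symm.injective ?_⟩
    change complexCurve γ _ = _
    rw [hz, tangent_eq_exp_of_curvature_eq hγ hc, mul_div_cancel₀ _ hc0.ne', hφ,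
      mul_div_cancel₀ _ hτ0, mul_div_cancel_right₀ _ (mul_ne_zero Complex.I_ne_zero hc0'), hq]
    abel

/-- A curve on a circle of radius `r` has curvature `1 / r`: differentiate `‖ζ - z‖² = r²`
twice. -/
theorem curvature_eq_of_range_eq_sphere (hγ : IsSmoothSimpleClosedArcLength γ)
    (hκ : ∀ s, 0 < curvature γ s) {r : ℝ} (hr : 0 < r) {z : EuclideanSpace ℝ (Fin 2)}
    (hz : Set.range γ = Metric.sphere z r) (x : AddCircle ℓ) : curvature γ x = 1 / r := by
  set ζ := complexCurve γ with hζ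
  set τ := tangent γ with hτ
  set p : ℂ := Complex.orthonormalBasisOneI.repr.symm z with hp
  have hnorm : ∀ x, ‖ζ x - p‖ = r := fun x => by
    have h1 : γ x ∈ Metric.sphere z r := hz ▸ Set.mem_range_self x
    rw [mem_sphere_iff_norm, ← Complex.orthonormalBasisOneI.repr.symm.norm_map, map_sub] at h1
    exact h1
  have hdζ : ∀ s : ℝ, HasDerivAt (fun s : ℝ => ζ (s : AddCircle ℓ) - p) (τ (s : AddCircle ℓ)) s :=
    fun s => ((isSmooth_complexCurve hγ.smooth).hasDerivAt s).sub_const p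
  have hdτ := (isSmooth_tangent hγ.smooth).hasDerivAt
  have hconj : ∀ s : ℝ, HasDerivAt (fun s : ℝ => (starRingEnd ℂ) (ζ (s : AddCircle ℓ) - p))
      ((starRingEnd ℂ) (τ (s : AddCircle ℓ))) s := fun s =>
    Complex.conjCLE.toContinuousLinearMap.hasFDerivAt.comp_hasDerivAt s (hdζ s)
  have h1 : ∀ s : ℝ, ((starRingEnd ℂ) (ζ (s : AddCircle ℓ) - p) * τ (s : AddCircle ℓ)).re = 0 := by
    intro s
    have h2 : HasDerivAt (fun _ : ℝ => ((r : ℂ) ^ 2)) _ s :=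
      ((hconj s).mul (hdζ s)).congr_of_eventuallyEq (.of_forall fun t => by
        simp only [Pi.mul_apply]
        rw [Complex.conj_mul', hnorm])
    have h3 := congrArg Complex.re (h2.unique (hasDerivAt_const s _))
    simp at h3 ⊢
    linarith
  induction x using QuotientAddGroup.induction_on with
  | H s =>
    have h2 := Complex.reCLM.hasFDerivAt.comp_hasDerivAt s ((hconj s).mul (hdτ s))
    have h3 : HasDerivAt (fun _ : ℝ => (0 : ℝ)) _ s := h2.congr_of_eventuallyEq
      (.of_forall fun t => (h1 t).symm)
    have h4 := h3.unique (hasDerivAt_const s _)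
    rw [← hτ, circleDeriv_tangent hγ, ← hτ, Complex.conj_mul', norm_tangent hγ] at h4
    set q := (starRingEnd ℂ) (ζ (s : AddCircle ℓ) - p) * τ (s : AddCircle ℓ) with hq
    have h5 : (starRingEnd ℂ) (ζ (s : AddCircle ℓ) - p) *
        (Complex.I * curvature γ s * τ (s : AddCircle ℓ)) = Complex.I * curvature γ s * q := by
      rw [hq]; ring
    rw [h5] at h4
    have h6 : 1 - curvature γ s * q.im = 0 := by simpa [sub_eq_add_neg] using h4
    have h7 : ‖q‖ = r := by rw [hq, norm_mul, RCLike.norm_conj, hnorm, norm_tangent hγ, mul_one]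
    have h8 : r ^ 2 = q.im ^ 2 := by
      rw [← h7, Complex.sq_norm, Complex.normSq_apply, h1 s]
      ring
    have hk := hκ (s : AddCircle ℓ)
    have h9 : 0 < q.im := by
      by_contra hneg
      nlinarith
    have h10 : r = q.im := by nlinarith
    rw [h10, eq_div_iff h9.ne']
    linarith

end Curve

/-! ### The tangent as a test function -/

section TestFunction

variable {ℓ : ℝ} [hℓ : Fact (0 < ℓ)] {γ : AddCircle ℓ → EuclideanSpace ℝ (Fin 2)}

theorem integral_curvature_mul_tangent (hγ : IsSmoothSimpleClosedArcLength γ) :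
    ∫ s, (curvature γ s : ℂ) * tangent γ s = 0 := by
  have h : ∀ s, (curvature γ s : ℂ) * tangent γ s = -Complex.I * circleDeriv (tangent γ) s :=
    fun s => by
      rw [circleDeriv_tangent hγ]
      linear_combination ((curvature γ s : ℂ) * tangent γ s) * Complex.I_sq
  simp only [h]
  rw [integral_const_mul, integral_circleDeriv (isSmooth_tangent hγ.smooth), mul_zero]

omit hℓ in
theorem applyB_tangent (hγ : IsSmoothSimpleClosedArcLength γ) (hκ : ∀ s, 0 < curvature γ s)
    (hc : Continuous (curvature γ)) (s : AddCircle ℓ) :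
    applyB hc hκ (isSmooth_tangent hγ.smooth) s =
      ((curvature γ s / 2 : ℝ) -
        Complex.I * (circleDeriv (curvature γ) s / (2 * curvature γ s) : ℝ)) * tangent γ s := by
  have h : (curvature γ s : ℂ) ≠ 0 := Complex.ofReal_ne_zero.2 (hκ s).ne'
  simp only [applyB, ContinuousMap.coe_mk, circleDeriv_circleDeriv_tangent hγ]
  push_cast
  field_simp
  ring

variable [IsFiniteMeasure (weight (curvature γ))]

theorem re_inner_tangent_applyB (hγ : IsSmoothSimpleClosedArcLength γ)
    (hκ : ∀ s, 0 < curvature γ s) (hc : Continuous (curvature γ)) :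
    (inner ℂ (toL2 (curvature γ) ⟨tangent γ, (isSmooth_tangent hγ.smooth).continuous⟩)
      (toL2 (curvature γ) (applyB hc hκ (isSmooth_tangent hγ.smooth)))).re =
      1 / 2 * ∫ s, curvature γ s ^ 2 := by
  have hc' : Continuous (circleDeriv (curvature γ)) :=
    (isSmooth_curvature hγ.smooth).circleDeriv.continuous
  have hcomp : ∀ f : AddCircle ℓ → ℝ, Continuous f → Integrable (fun s => (f s : ℂ)) := fun f hf =>
    (Complex.continuous_ofReal.comp hf).integrable_of_hasCompactSupport
      (HasCompactSupport.of_compactSpace _)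
  have h : ∀ s, (curvature γ s : ℂ) * (applyB hc hκ (isSmooth_tangent hγ.smooth) s *
      (starRingEnd ℂ) (tangent γ s)) =
      ((1 / 2 * curvature γ s ^ 2 : ℝ) : ℂ) -
        Complex.I / 2 * (circleDeriv (curvature γ) s : ℝ) := by
    intro s
    have h0 : (curvature γ s : ℂ) ≠ 0 := Complex.ofReal_ne_zero.2 (hκ s).ne'
    rw [applyB_tangent hγ hκ hc, mul_assoc, Complex.mul_conj', norm_tangent hγ]
    push_cast
    field_simp
  rw [inner_toL2 hc hκ]
  simp only [ContinuousMap.coe_mk, h]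
  rw [integral_sub (hcomp _ (by fun_prop)) ((hcomp _ hc').const_mul _), integral_const_mul,
    integral_complex_ofReal, integral_complex_ofReal,
    integral_circleDeriv (isSmooth_curvature hγ.smooth), Complex.ofReal_zero, mul_zero, sub_zero,
    Complex.ofReal_re, integral_const_mul]

/-- For constant `κ = c` with `cℓ = 2π` the trigonometric monomials are eigenfunctions, with
eigenvalues `c n² / 2`, and there are no others because their span is dense. -/
theorem half_le_of_mem_positiveEigenvalues {κ : AddCircle ℓ → ℝ} [IsFiniteMeasure (weight κ)]
    {c : ℝ} (hc0 : 0 < c) (hκ : ∀ s, κ s = c) (hcℓ : c * ℓ = 2 * Real.pi) {μ : ℝ}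
    (hμ : μ ∈ positiveEigenvalues (operatorB κ)) : c / 2 ≤ μ := by
  have hκc : Continuous κ := by rw [funext hκ]; exact continuous_const
  have hpos : ∀ s, 0 < κ s := fun s => by rw [hκ]; exact hc0
  have hR := isReducedInverse_reducedGreen hκc hpos
  obtain ⟨hμ0, u, hu, hGu⟩ := hR.mem_positiveEigenvalues_iff.1 hμ
  obtain ⟨n, hn⟩ : ∃ n : ℤ, inner ℂ (toL2 κ (fourier n)) u ≠ 0 := by
    by_contra! h
    exact hu (eq_zero_of_inner_mul_fourier_eq_zero (ρ := 1) (by simp) (by simpa using h))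
  have hgraph : (toL2 κ (fourier n), ((c * n ^ 2 / 2 : ℝ) : ℂ) • toL2 κ (fourier n)) ∈
      (operatorB κ).graph := by
    refine (mem_graph_operatorB_iff hκc hpos).2 ⟨fourier n, IsSmooth.of_fourier n, rfl, ?_⟩
    rw [← map_smul]
    congr 1
    ext s
    have hc' : (c : ℂ) ≠ 0 := Complex.ofReal_ne_zero.2 hc0.ne'
    have h1 : 2 * Real.pi * n / ℓ = c * n := by
      rw [← hcℓ, div_eq_iff hℓ.out.ne']
      ring
    rw [applyB_fourier, h1, hκ]
    simp only [ContinuousMap.smul_apply, smul_eq_mul]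
    push_cast
    field_simp
  have h1 := hR.eigenvalue_eq_of_inner_ne_zero hgraph hμ0 hGu hn
  have h2 : n ≠ 0 := by
    rintro rfl
    simp [h1] at hμ0
  have h3 : (1 : ℝ) ≤ (n : ℝ) ^ 2 := by
    have h4 : 1 ≤ n ^ 2 := by
      have := pow_pos (abs_pos.2 h2) 2
      rw [sq_abs] at this
      linarith
    exact_mod_cast h4
  rw [h1]
  nlinarith

end TestFunction

end CurveSpectrum

theorem mainTheorem2 (ℓ : ℝ) [Fact (0 < ℓ)] (γ : AddCircle ℓ → EuclideanSpace ℝ (Fin 2))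
    (hγ : CurveSpectrum.IsSmoothSimpleClosedArcLength γ)
    (hκ : ∀ s, 0 < CurveSpectrum.curvature γ s) :
    CurveSpectrum.IsNonnegative (CurveSpectrum.operatorB (CurveSpectrum.curvature γ)) ∧
    CurveSpectrum.IsEssentiallySelfAdjoint
      (CurveSpectrum.operatorB (CurveSpectrum.curvature γ)) ∧
    ∃ lam : ℝ,
      IsLeast (CurveSpectrum.positiveEigenvalues
        (CurveSpectrum.operatorB (CurveSpectrum.curvature γ))) lam ∧
      lam ≤ 1 / (4 * Real.pi) * ∫ s : AddCircle ℓ, CurveSpectrum.curvature γ s ^ 2 ∧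
      (lam = 1 / (4 * Real.pi) * ∫ s : AddCircle ℓ, CurveSpectrum.curvature γ s ^ 2 ↔
        ∃ c : ℝ, ∀ s, CurveSpectrum.curvature γ s = c) ∧
      ((∃ c : ℝ, ∀ s, CurveSpectrum.curvature γ s = c) ↔
        ∃ z : EuclideanSpace ℝ (Fin 2), Set.range γ = Metric.sphere z (1 / (2 * lam))) := by
  open CurveSpectrum in
  have hc : Continuous (curvature γ) := (isSmooth_curvature hγ.smooth).continuous
  have := isFiniteMeasure_weight hc
  have hR := isReducedInverse_reducedGreen hc hκ
  set G := reducedGreen (curvature γ)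
  have hτ := isSmooth_tangent hγ.smooth
  set u := toL2 (curvature γ) ⟨tangent γ, hτ.continuous⟩ with hu
  set f := toL2 (curvature γ) (applyB hc hκ hτ) with hf
  have hgraph : (u, f) ∈ (operatorB (curvature γ)).graph :=
    (mem_graph_operatorB_iff hc hκ).2 ⟨tangent γ, hτ, rfl, rfl⟩
  have horth : inner ℂ (toL2 (curvature γ) 1) u = 0 := by
    rw [hu, inner_toL2 hc hκ]
    simpa using integral_curvature_mul_tangent hγ
  have hnorm : ‖u‖ ^ 2 = ∫ s, curvature γ s := norm_sq_toL2 hc hκ (norm_tangent hγ)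
  have hre : (inner ℂ u f).re = 1 / 2 * ∫ s, curvature γ s ^ 2 := re_inner_tangent_applyB hγ hκ hc
  have htotal := two_pi_le_integral_curvature hγ hκ
  have hpi := Real.pi_pos
  have hG : G ≠ 0 := by
    intro h
    have h1 : u = 0 := by rw [hR.eq_apply hgraph horth, h]; rfl
    rw [h1, norm_zero] at hnorm
    nlinarith
  have hleast := hR.isLeast_positiveEigenvalues hG
  have hlam : 0 < ‖G‖⁻¹ := hleast.1.1
  have hray := hR.rayleigh hG hgraph horth
  rw [hnorm, hre] at hray
  have hbound : ‖G‖⁻¹ ≤ 1 / (4 * Real.pi) * ∫ s, curvature γ s ^ 2 := by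
    rw [one_div, le_inv_mul_iff₀ (by positivity)]
    nlinarith
  have hconst : ∀ c : ℝ, (∀ s, curvature γ s = c) →
      0 < c ∧ ‖G‖⁻¹ = c / 2 ∧ c / 2 = 1 / (4 * Real.pi) * ∫ s, curvature γ s ^ 2 := by
    intro c hcc
    have hc0 : 0 < c := hcc 0 ▸ hκ 0
    have hcℓ := mul_length_eq_two_pi hγ hc0 hcc
    have h1 := half_le_of_mem_positiveEigenvalues hc0 hcc hcℓ hleast.1
    have h2 : c / 2 = 1 / (4 * Real.pi) * ∫ s, curvature γ s ^ 2 := by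
      have hvol : volume.real (Set.univ : Set (AddCircle ℓ)) = ℓ := by
        rw [Measure.real, AddCircle.measure_univ, ENNReal.toReal_ofReal (Fact.out : 0 < ℓ).le]
      simp only [hcc, integral_const, hvol, smul_eq_mul]
      have h3 : ℓ * c ^ 2 = 2 * Real.pi * c := by rw [← hcℓ]; ring
      rw [h3]
      field_simp
      norm_num
    exact ⟨hc0, le_antisymm (h2 ▸ hbound) h1, h2⟩
  refine ⟨hR.isNonnegative, hR.isEssentiallySelfAdjoint, ‖G‖⁻¹, hleast, hbound, ⟨?_, ?_⟩, ⟨?_, ?_⟩⟩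
  · intro heq
    -- equality in the bound forces equality in the Rayleigh quotient of the tangent
    have h1 : ‖G‖⁻¹ * ‖u‖ ^ 2 = (inner ℂ u f).re := by
      rw [hnorm, hre]
      refine le_antisymm hray ?_
      have h2 : ∫ s, curvature γ s ^ 2 = 4 * Real.pi * ‖G‖⁻¹ := by
        rw [heq]
        field_simp
      rw [h2]
      nlinarith
    have h2 := hR.eq_smul_of_rayleigh_eq hG hgraph horth h1
    rw [hf, hu, ← map_smul] at h2
    have h3 := toL2_injective hc hκ h2
    refine ⟨2 * ‖G‖⁻¹, fun s => ?_⟩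
    have h4 := DFunLike.congr_fun h3 s
    rw [applyB_tangent hγ hκ hc, ContinuousMap.smul_apply, ContinuousMap.coe_mk, smul_eq_mul] at h4
    have hτ0 : tangent γ s ≠ 0 := norm_ne_zero_iff.1 (by rw [norm_tangent hγ]; exact one_ne_zero)
    have h5 := congrArg Complex.re (mul_right_cancel₀ hτ0 h4)
    simp only [Complex.sub_re, Complex.ofReal_re, Complex.I_mul_re, Complex.ofReal_im, neg_zero,
      sub_zero] at h5
    linarith
  · rintro ⟨c, hcc⟩
    obtain ⟨-, h1, h2⟩ := hconst c hcc
    exact h1.trans h2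
  · rintro ⟨c, hcc⟩
    obtain ⟨hc0, h1, -⟩ := hconst c hcc
    rw [h1, mul_div_cancel₀ _ two_ne_zero]
    exact exists_range_eq_sphere hγ hc0 hcc
  · rintro ⟨z, hz⟩
    exact ⟨_, curvature_eq_of_range_eq_sphere hγ hκ (by positivity) hz⟩
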